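/- Let $V_n=\mathbb{C}^n$, with $V_0\subset V_1\subset V_2\subset\cdots$ the standard inclusions (onto the span of the first basis vectors). For integers $0\le r\le k$ and $s\ge 1$ let $$\sigma_s^r\operatorname{Gr}(k,V_n)=\overline{\Big\{[\lambda_1\widehat E_1+\cdots+\lambda_s\widehat E_s]\ :\ E_1,\dots,E_s\in \operatorname{Gr}(k,V_n),\ \dim(E_1\cap\cdots\cap E_s)\ge r\Big\}}\subset\mathbb{P}\big(\textstyle\bigwedge^k V_n\big)$$ (Zariski closure) be the $r$-restricted $s$-secant variety of the Grassmannian, where $\widehat E\in\bigwedge^k V_n$ is a vector representing the Plücker point of $E$, $\lambda_i\in\mathbb{C}$, and only nonzero sums are considered. The family $(\sigma_s^r\operatorname{Gr}(k,V_n))_{n\ge 0}$ has orbit stability at step $p$ if $\operatorname{GL}(V_j).\sigma_s^r\operatorname{Gr}(k,V_i)=\sigma_s^r\operatorname{Gr}(k,V_j)$ whenever $p\le i\le j$. The family has orbit stability at step $r+s(k-r)$. Let $p$ be the first step at which it has orbit stability. Then: 1. $p=r+s(k-r)$, unless $s\ge 2$ and $k=r+1$ (the case in which $\sigma_s^r\operatorname{Gr}(k,V_n)=\operatorname{Gr}(k,V_n)$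 collapses). 2. For all $n\ge p$, $$\dim \sigma_s^r\operatorname{Gr}(k,V_n)=\dim\sigma_s^r\operatorname{Gr}(k,V_p)+\dim\operatorname{Gr}(p,n).$$ 3. If $s\ge 2$ and $k-r\ge 3$, or if $s=1$ and $r\in\{0,k\}$, then for all $n\ge p$, $$\dim \sigma_s^r\operatorname{Gr}(k,V_n)=r(p-r)+s(k-r)(p-k)+s-1+p(n-p).$$ -/

import Mathlib

open scoped LinearAlgebra.Projectivization

noncomputable section

namespace RestrictedSecant

/-! ### Projective varieties in a complex projective space with linear coordinates -/

section ProjectiveGeometry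

variable {ι W : Type*} [AddCommGroup W] [Module ℂ W]

/-- The Zariski closure of a subset `S` of `ℙ(W)`, with respect to the homogeneous coordinates given
by the basis `b` of `W`: the common zeros of all homogeneous polynomials vanishing on `S`.
(The vanishing of a homogeneous polynomial at a point does not depend on the representative.) -/
def zariskiClosure (b : Module.Basis ι ℂ W) (S : Set (ℙ ℂ W)) : Set (ℙ ℂ W) :=
  {x | ∀ (d : ℕ) (F : MvPolynomial ι ℂ), F.IsHomogeneous d →
    (∀ y ∈ S, MvPolynomial.eval (b.repr y.rep) F = 0) →
      MvPolynomial.eval (b.repr x.rep) F = 0}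

/-- The affine cone over `X ⊆ ℙ(W)` (without its vertex, which changes nothing for the vanishing
ideal when `X` is nonempty), in the coordinates given by `b`. -/
def affineCone (b : Module.Basis ι ℂ W) (X : Set (ℙ ℂ W)) : Set (ι → ℂ) :=
  {c | ∃ (w : W) (hw : w ≠ 0), Projectivization.mk ℂ w hw ∈ X ∧ c = b.repr w}

/-- The homogeneous coordinate ring of `X ⊆ ℙ(W)`, that is, the coordinate ring of the affine cone
over `X`. It only depends on the Zariski closure of `X`. -/
abbrev CoordinateRing (b : Module.Basis ι ℂ W) (X : Set (ℙ ℂ W)) : Type _ :=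
  MvPolynomial ι ℂ ⧸ MvPolynomial.vanishingIdeal ℂ (affineCone b X)

/-- The dimension of a projective variety `X`: the dimension of its affine cone (the Krull dimension
of the coordinate ring of the cone) minus one. The empty variety has dimension `⊥`. -/
def projDim (b : Module.Basis ι ℂ W) (X : Set (ℙ ℂ W)) : WithBot ℕ∞ :=
  WithBot.map (fun d : ℕ∞ => d - 1) (ringKrullDim (CoordinateRing b X))

end ProjectiveGeometry

/-! ### Grassmannians and their restricted secant varieties -/

/-- The vector space `V_n = ℂⁿ`. -/
abbrev V (n : ℕ) : Type := Fin n → ℂ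

/-- The basis of Plücker coordinates `e_{i_1} ∧ ⋯ ∧ e_{i_k}`, `i_1 < ⋯ < i_k`, of `⋀ᵏ V_n`. -/
def pluckerBasis (k n : ℕ) :
    Module.Basis (Set.powersetCard (Fin n) k) ℂ (⋀[ℂ]^k (V n)) :=
  (Pi.basisFun ℂ (Fin n)).exteriorPower k

/-- `ω = e_1 ∧ ⋯ ∧ e_k` for some basis `e_1, …, e_k` of the `k`-plane `E`: a representative in
`⋀ᵏ V_n` of the Plücker point of `E`. In particular `E` has dimension `k`. -/
def IsPluckerRep {k n : ℕ} (E : Submodule ℂ (V n)) (ω : ⋀[ℂ]^k (V n)) : Prop :=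
  ∃ e : Fin k → V n, LinearIndependent ℂ e ∧ Submodule.span ℂ (Set.range e) = E ∧
    ω = exteriorPower.ιMulti ℂ k e

/-- The Grassmannian `Gr(k, V_n)` in its Plücker embedding in `ℙ(⋀ᵏ V_n)`. -/
def grassmannian (k n : ℕ) : Set (ℙ ℂ (⋀[ℂ]^k (V n))) :=
  {x | ∃ (E : Submodule ℂ (V n)) (ω : ⋀[ℂ]^k (V n)) (hω : ω ≠ 0),
    IsPluckerRep E ω ∧ x = Projectivization.mk ℂ ω hω}

/-- The points `[λ_1 Ê_1 + ⋯ + λ_s Ê_s]` of `ℙ(⋀ᵏ V_n)` where `E_1, …, E_s` are `k`-planes of `V_n`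
with `dim (E_1 ∩ ⋯ ∩ E_s) ≥ r`. -/
def restrictedSecantPoints (k r s n : ℕ) : Set (ℙ ℂ (⋀[ℂ]^k (V n))) :=
  {x | ∃ (E : Fin s → Submodule ℂ (V n)) (ω : Fin s → ⋀[ℂ]^k (V n)) (c : Fin s → ℂ)
      (h : ∑ i, c i • ω i ≠ 0),
    (∀ i, IsPluckerRep (E i) (ω i)) ∧
    r ≤ Module.finrank ℂ (⨅ i, E i : Submodule ℂ (V n)) ∧
    x = Projectivization.mk ℂ (∑ i, c i • ω i) h}

/-- The `r`-restricted `s`-secant variety `σ_s^r(Gr(k, V_n)) ⊆ ℙ(⋀ᵏ V_n)`. -/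
def restrictedSecant (k r s n : ℕ) : Set (ℙ ℂ (⋀[ℂ]^k (V n))) :=
  zariskiClosure (pluckerBasis k n) (restrictedSecantPoints k r s n)

/-! ### The orbit family and orbit stability -/

/-- The inclusion `V_i ⊆ V_j` for `i ≤ j`, onto the span of the first `i` basis vectors. -/
def incl {i j : ℕ} (hij : i ≤ j) : V i →ₗ[ℂ] V j :=
  Function.ExtendByZero.linearMap ℂ (Fin.castLE hij)

theorem incl_injective {i j : ℕ} (hij : i ≤ j) : Function.Injective (incl hij) := by
  intro x y h
  exact Function.extend_injective (Fin.castLE_injective hij) (0 : Fin j → ℂ) h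

/-- The set `GL(V_j).X` of all translates under `GL(V_j)` of the points of `X ⊆ ℙ(⋀ᵏ V_i)`, where
`ℙ(⋀ᵏ V_i)` is regarded as a subspace of `ℙ(⋀ᵏ V_j)` through the inclusion `V_i ⊆ V_j`. -/
def glTranslates {k i j : ℕ} (hij : i ≤ j) (X : Set (ℙ ℂ (⋀[ℂ]^k (V i)))) :
    Set (ℙ ℂ (⋀[ℂ]^k (V j))) :=
  {x | ∃ g : V j ≃ₗ[ℂ] V j, ∃ y ∈ X,
    x = Projectivization.map (exteriorPower.map k (g.toLinearMap ∘ₗ incl hij))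
      (exteriorPower.map_injective_field (g.injective.comp (incl_injective hij))) y}

/-- Orbit stability of the family `(σ_s^r Gr(k, V_i))_i` occurs at step `p`:
`GL(V_j).σ_s^r Gr(k, V_i) = σ_s^r Gr(k, V_j)` whenever `p ≤ i ≤ j`. -/
def OrbitStableAt (k r s p : ℕ) : Prop :=
  ∀ (i j : ℕ) (hij : i ≤ j), p ≤ i →
    glTranslates hij (restrictedSecant k r s i) = restrictedSecant k r s j

end RestrictedSecant

end

/-!
Write `k = r + m` and `N = r + s * m`. A restricted secant point is the class of
`∑ i, λ_i v_1 ∧ ⋯ ∧ v_r ∧ w_{i,1} ∧ ⋯ ∧ w_{i,m}`, a form in `N` vectors. The smallest subspace `U`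
with `ω ∈ ⋀ᵏ U` is spanned by the contractions of `ω` with `k - 1` linear forms, and its dimension
being at most `N` is a Zariski closed condition, so every point of the closure comes from an
`N`-dimensional subspace: orbit stability occurs at step `N`. If `s = 1` or `m ≥ 2`, the subspace of
a generic secant vector has dimension exactly `N`, so this is the first step. If `s = 1` or `m ≤ 1`,
the sum is decomposable and the variety is the Grassmannian `Gr(k, V_n)`.

The homogeneous coordinate ring is the algebra generated by the Plücker coordinates of a generic
secant vector, and its dimension is the transcendence degree of this algebra. In `V_{N + e}` the
secant vector may be taken in `⋀ᵏ` of the graph of a generic linear map `V_N → V_e`. By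
multilinearity its Plücker coordinates determine the `N * e` entries of that map through a linear
system whose coefficients are Plücker coordinates over `V_N`, so the dimension grows by
`N * e = dim Gr(N, N + e)`.

For the explicit dimension, row operations bring the vectors spanning generic planes `E_1, …, E_s`
into an affine chart around coordinate subspaces. For `m ≥ 3` two of these subspaces differ in so
many basis vectors that exchanging a single basis vector in each of them never leads to the same
Plücker coordinate, so that the Jacobian matrix of the chart is the identity at the base point.
-/

noncomputable section

namespace RestrictedSecant

/-! ### Krull dimension and transcendence degree -/

theorem ringKrullDim_eq_of_isIntegral {R S : Type*} [CommRing R] [CommRing S] [Algebra R S]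
    [Algebra.IsIntegral R S] (hinj : Function.Injective (algebraMap R S)) :
    ringKrullDim S = ringKrullDim R := by
  apply le_antisymm
  · exact Order.krullDim_le_of_strictMono (PrimeSpectrum.comap (algebraMap R S))
      fun _ _ hpq => Ideal.IsIntegral.comap_lt_comap (R := R) hpq
  · refine iSup_le fun l => ?_
    have hker : Ideal.comap (algebraMap R S) ⊥ ≤ l.head.asIdeal := by
      rw [← RingHom.ker_eq_comap_bot, (RingHom.injective_iff_ker_eq_bot _).1 hinj]
      exact bot_le
    obtain ⟨Q, -, hQ, hcomap⟩ :=
      Ideal.exists_ideal_over_prime_of_isIntegral (S := S) l.head.asIdeal ⊥ hker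
    have : Q.LiesOver l.head.asIdeal := ⟨hcomap.symm⟩
    obtain ⟨L, hL, -⟩ := Ideal.exists_ltSeries_of_hasGoingUp l Q
    exact le_iSup_of_le L (by rw [hL])

theorem ringKrullDim_eq_toNat_trdeg (K A : Type*) [Field K] [CommRing A] [IsDomain A]
    [Algebra K A] [Algebra.FiniteType K A] :
    ringKrullDim A = (Algebra.trdeg K A).toNat := by
  obtain ⟨m, g, hg, hint⟩ := exists_integral_inj_algHom_of_fg K A
  algebraize [g.toRingHom]
  have : Algebra.IsIntegral (MvPolynomial (Fin m) K) A := ⟨hint⟩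
  have hinj : Function.Injective (algebraMap (MvPolynomial (Fin m) K) A) := hg
  have : FaithfulSMul (MvPolynomial (Fin m) K) A :=
    (faithfulSMul_iff_algebraMap_injective _ _).2 hinj
  have : IsScalarTower K (MvPolynomial (Fin m) K) A :=
    IsScalarTower.of_algebraMap_eq fun x => (g.commutes x).symm
  have htrdeg := lift_trdeg_add_eq K (MvPolynomial (Fin m) K) A
  rw [MvPolynomial.trdeg_of_isDomain, trdeg_eq_zero] at htrdeg
  have hm : (Algebra.trdeg K A).toNat = m := by
    simpa using (congrArg Cardinal.toNat htrdeg).symm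
  rw [ringKrullDim_eq_of_isIntegral hinj, MvPolynomial.ringKrullDim_of_isNoetherianRing,
    ringKrullDim_eq_zero_of_field, hm]
  simp

/-! ### The Jacobian criterion -/

section Jacobian

open MvPolynomial

theorem derivation_aeval {R A M ι : Type*} [CommSemiring R] [CommSemiring A] [Algebra R A]
    [AddCommMonoid M] [Module R M] [Module A M] [IsScalarTower R A M] [Fintype ι]
    (D : Derivation R A M) (P : ι → A) (F : MvPolynomial ι R) :
    D (aeval P F) = ∑ d, aeval P (pderiv d F) • D (P d) := by
  classical
  induction F using MvPolynomial.induction_on with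
  | C a => simp
  | add F G hF hG => simp only [map_add, hF, hG, add_smul, Finset.sum_add_distrib]
  | mul_X F e hF =>
    simp only [map_mul, aeval_X, Derivation.leibniz, hF, pderiv_X, map_add, add_smul, smul_eq_mul,
      Finset.sum_add_distrib, Finset.smul_sum, smul_smul]
    congr 1
    rw [Finset.sum_eq_single e (fun d _ hd => by simp [hd.symm]) (by simp)]
    simp

theorem eval_pderiv_of_eval_line {R σ : Type*} [CommRing R] [IsDomain R] [Infinite R] [Finite σ]
    [DecidableEq σ] {F : MvPolynomial σ R} {z : σ → R} {i : σ} {a c : R}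
    (h : ∀ τ : R, eval (z + Pi.single i τ) F = a + c * τ) : eval z (pderiv i F) = c := by
  cases nonempty_fintype σ
  let line : σ → Polynomial R := fun j =>
    Polynomial.C (z j) + Pi.single (M := fun _ => Polynomial R) i Polynomial.X j
  have heval (τ : R) (G : MvPolynomial σ R) :
      (aeval line G).eval τ = eval (z + Pi.single i τ) G := by
    have hpt : (fun j => (line j).eval τ) = z + Pi.single i τ := by
      ext j
      rcases eq_or_ne j i with rfl | hj <;> simp [line, *]
    rw [← hpt, ← Polynomial.coe_evalRingHom, aeval_def, eval₂_eq', eval_eq']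
    simp [Polynomial.eval_prod]
  have hline : aeval line F = Polynomial.C a + Polynomial.C c * Polynomial.X :=
    Polynomial.funext fun τ => by simp [heval, h]
  have hderiv (d : σ) :
      Polynomial.derivative (line d) = Pi.single (M := fun _ => Polynomial R) i 1 d := by
    rcases eq_or_ne d i with rfl | hd <;> simp [line, *]
  have hchain := congrArg (Polynomial.eval 0) (derivation_aeval Polynomial.derivative' line F)
  simpa [hline, hderiv, Pi.single_apply, Polynomial.eval_finsetSum, heval] using hchain.symm

theorem totalDegree_pderiv_lt {R ι : Type*} [CommSemiring R] {F : MvPolynomial ι R} {d : ι}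
    (h : pderiv d F ≠ 0) : (pderiv d F).totalDegree < F.totalDegree := by
  have hlt : ∀ m ∈ (pderiv d F).support, m.degree < F.totalDegree := by
    intro m hm
    rw [mem_support_iff, coeff_pderiv] at hm
    have hle : (m + Finsupp.single d 1).degree ≤ F.totalDegree :=
      le_totalDegree (mem_support_iff.2 (left_ne_zero_of_mul hm))
    rw [map_add, Finsupp.degree_single] at hle
    omega
  obtain ⟨m, hm⟩ := support_nonempty.2 h
  exact (Finset.sup_lt_iff ((Nat.zero_le _).trans_lt (hlt m hm))).2 hlt

variable {R ι : Type*} [CommRing R] [IsDomain R] [CharZero R]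

theorem eq_C_of_pderiv_eq_zero {F : MvPolynomial ι R} (h : ∀ d, pderiv d F = 0) :
    F = C (coeff 0 F) := by
  classical
  ext m
  rw [coeff_C]
  split_ifs with hm
  · rw [hm]
  · obtain ⟨d, hd⟩ : ∃ d, m d ≠ 0 := by
      by_contra! hc
      exact hm (Finsupp.ext hc).symm
    have hcoeff := congrArg (coeff (m - Finsupp.single d 1)) (h d)
    have hle : Finsupp.single d 1 ≤ m := by
      simpa [Finsupp.single_le_iff] using Nat.one_le_iff_ne_zero.2 hd
    rw [coeff_pderiv, tsub_add_cancel_of_le hle, coeff_zero] at hcoeff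
    exact (mul_eq_zero.1 hcoeff).resolve_right (Nat.cast_add_one_ne_zero _)

theorem algebraicIndependent_of_det_jacobian_ne_zero {σ : Type*} [Fintype ι] [DecidableEq ι]
    (P : ι → MvPolynomial σ R) (j : ι → σ) (z : σ → R)
    (hdet : (Matrix.of fun d d' => eval z (pderiv (j d) (P d'))).det ≠ 0) :
    AlgebraicIndependent R P := by
  have hJ : (Matrix.of fun d d' => pderiv (j d) (P d')).det ≠ 0 := by
    intro h
    apply hdet
    simpa [RingHom.map_det, RingHom.mapMatrix_apply, Matrix.map] using congrArg (eval z) h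
  rw [algebraicIndependent_iff]
  intro F
  induction hN : F.totalDegree using Nat.strong_induction_on generalizing F with
  | _ N ih =>
    intro hF
    have hgrad : (fun d => aeval P (pderiv d F)) = 0 := by
      refine Matrix.eq_zero_of_mulVec_eq_zero hJ (funext fun d => ?_)
      have hchain := derivation_aeval (pderiv (j d)) P F
      rw [hF, map_zero] at hchain
      simpa only [Matrix.mulVec, dotProduct, Matrix.of_apply, smul_eq_mul, mul_comm,
        Pi.zero_apply] using hchain.symm
    have hC : F = C (coeff 0 F) := eq_C_of_pderiv_eq_zero fun d => by
      by_contra hne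
      exact hne (ih _ (hN ▸ totalDegree_pderiv_lt hne) _ rfl (congrFun hgrad d))
    rw [hC] at hF ⊢
    simpa using hF

end Jacobian

theorem eq_zero_of_eval_eq_zero_of_eval_ne_zero {R σ : Type*} [CommRing R] [IsDomain R]
    [Infinite R] {F G : MvPolynomial σ R} (hG : G ≠ 0)
    (h : ∀ z, MvPolynomial.eval z G ≠ 0 → MvPolynomial.eval z F = 0) : F = 0 := by
  have hGF : G * F = 0 := by
    refine MvPolynomial.funext fun z => ?_
    by_cases hz : MvPolynomial.eval z G = 0
    · simp [hz]
    · simp [h z hz]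
  exact (mul_eq_zero.1 hGF).resolve_left hG

/-! ### Affine cones -/

section Cones

open MvPolynomial

theorem eval_smul_of_isHomogeneous {R ι : Type*} [CommSemiring R] {F : MvPolynomial ι R} {d : ℕ}
    (hF : F.IsHomogeneous d) (c : R) (x : ι → R) : eval (c • x) F = c ^ d * eval x F := by
  rw [eval_eq, eval_eq, Finset.mul_sum]
  refine Finset.sum_congr rfl fun m hm => ?_
  have hd : ∑ i ∈ m.support, m i = d := by
    simpa [Finsupp.weight_apply, Finsupp.sum] using hF (mem_support_iff.1 hm)
  simp only [Pi.smul_apply, smul_eq_mul, mul_pow, Finset.prod_mul_distrib]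
  rw [Finset.prod_pow_eq_pow_sum, hd]
  ring

theorem eval_homogeneousComponent_eq_zero {R ι : Type*} [CommRing R] [IsDomain R] [Infinite R]
    {F : MvPolynomial ι R} {x : ι → R} (h : ∀ a : R, a ≠ 0 → eval (a • x) F = 0) (d : ℕ) :
    eval x (homogeneousComponent d F) = 0 := by
  let p : Polynomial R := ∑ i ∈ Finset.range (F.totalDegree + 1),
    Polynomial.C (eval x (homogeneousComponent i F)) * Polynomial.X ^ i
  have heval (a : R) : p.eval a = eval (a • x) F := by
    conv_rhs => rw [← sum_homogeneousComponent F]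
    simp only [p, Polynomial.eval_finsetSum, map_sum, Polynomial.eval_mul, Polynomial.eval_C,
      Polynomial.eval_pow, Polynomial.eval_X,
      eval_smul_of_isHomogeneous (homogeneousComponent_isHomogeneous _ F), mul_comm]
  have hXp : Polynomial.X * p = 0 := by
    refine Polynomial.funext fun a => ?_
    rcases eq_or_ne a 0 with rfl | ha
    · simp
    · simp [heval, h a ha]
  have hp : p = 0 := (mul_eq_zero.1 hXp).resolve_left Polynomial.X_ne_zero
  by_cases hd : d < F.totalDegree + 1
  · have hcoeff := congrArg (fun q => Polynomial.coeff q d) hp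
    simpa [p, Polynomial.finsetSum_coeff, Polynomial.coeff_C_mul, Polynomial.coeff_X_pow,
      Finset.sum_ite_eq, hd] using hcoeff
  · rw [homogeneousComponent_eq_zero _ _ (by omega), map_zero]

variable {ι W : Type*} [AddCommGroup W] [Module ℂ W]

theorem eval_rep_eq_zero_iff (b : Module.Basis ι ℂ W) {F : MvPolynomial ι ℂ} {d : ℕ}
    (hF : F.IsHomogeneous d) (w : W) (hw : w ≠ 0) :
    eval (b.repr (Projectivization.mk ℂ w hw).rep) F = 0 ↔ eval (b.repr w) F = 0 := by
  obtain ⟨a, ha⟩ := Projectivization.exists_smul_eq_mk_rep ℂ w hw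
  rw [← ha, Units.smul_def, map_smul, Finsupp.coe_smul, eval_smul_of_isHomogeneous hF]
  simp

theorem mk_mem_zariskiClosure_iff (b : Module.Basis ι ℂ W) (S : Set (ℙ ℂ W)) (w : W)
    (hw : w ≠ 0) : Projectivization.mk ℂ w hw ∈ zariskiClosure b S ↔
      ∀ (d : ℕ) (F : MvPolynomial ι ℂ), F.IsHomogeneous d →
        (∀ c ∈ affineCone b S, eval c F = 0) → eval (b.repr w) F = 0 := by
  refine forall₃_congr fun d F hF => ?_
  rw [eval_rep_eq_zero_iff b hF]
  refine imp_congr_left ⟨?_, ?_⟩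
  · rintro h _ ⟨v, hv, hvS, rfl⟩
    exact (eval_rep_eq_zero_iff b hF v hv).1 (h _ hvS)
  · intro h y hy
    exact h _ ⟨y.rep, y.rep_nonzero, by rwa [Projectivization.mk_rep], rfl⟩

theorem subset_zariskiClosure (b : Module.Basis ι ℂ W) (S : Set (ℙ ℂ W)) :
    S ⊆ zariskiClosure b S :=
  fun _ hx _ _ _ h => h _ hx

theorem smul_mem_affineCone {b : Module.Basis ι ℂ W} {S : Set (ℙ ℂ W)} {c : ι → ℂ}
    (hc : c ∈ affineCone b S) {a : ℂ} (ha : a ≠ 0) : a • c ∈ affineCone b S := by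
  obtain ⟨w, hw, hS, rfl⟩ := hc
  refine ⟨a • w, smul_ne_zero ha hw, ?_, by simp⟩
  rwa [(Projectivization.mk_eq_mk_iff' ℂ _ _ (smul_ne_zero ha hw) hw).2 ⟨a, rfl⟩]

theorem vanishingIdeal_affineCone_zariskiClosure (b : Module.Basis ι ℂ W) (S : Set (ℙ ℂ W)) :
    vanishingIdeal ℂ (affineCone b (zariskiClosure b S)) = vanishingIdeal ℂ (affineCone b S) := by
  apply le_antisymm
  · apply vanishingIdeal_anti_mono
    rintro _ ⟨w, hw, hS, rfl⟩
    exact ⟨w, hw, subset_zariskiClosure b S hS, rfl⟩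
  · intro F hF
    rw [mem_vanishingIdeal_iff] at hF ⊢
    rintro _ ⟨w, hw, hS, rfl⟩
    rw [mk_mem_zariskiClosure_iff] at hS
    rw [← sum_homogeneousComponent F, map_sum]
    refine Finset.sum_eq_zero fun i _ => ?_
    exact hS i _ (homogeneousComponent_isHomogeneous i F) fun c hc =>
      eval_homogeneousComponent_eq_zero
        (fun a ha => by simpa using hF _ (smul_mem_affineCone hc ha)) i

theorem projDim_zariskiClosure (b : Module.Basis ι ℂ W) (S : Set (ℙ ℂ W)) :
    projDim b (zariskiClosure b S) = projDim b S := by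
  unfold projDim CoordinateRing
  rw [vanishingIdeal_affineCone_zariskiClosure]

/-- The linear form `φ` on `W` as a polynomial in the coordinates given by `b`. -/
def linearForm [Fintype ι] (b : Module.Basis ι ℂ W) (φ : W →ₗ[ℂ] ℂ) : MvPolynomial ι ℂ :=
  ∑ i, C (φ (b i)) * X i

theorem linearForm_isHomogeneous [Fintype ι] (b : Module.Basis ι ℂ W) (φ : W →ₗ[ℂ] ℂ) :
    (linearForm b φ).IsHomogeneous 1 :=
  IsHomogeneous.sum _ _ _ fun i _ => by
    simpa using (isHomogeneous_C ι (φ (b i))).mul (isHomogeneous_X ℂ i)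

theorem eval_linearForm [Fintype ι] (b : Module.Basis ι ℂ W) (φ : W →ₗ[ℂ] ℂ) (w : W) :
    eval (b.repr w) (linearForm b φ) = φ w := by
  conv_rhs => rw [← b.sum_repr w]
  simp [-Module.Basis.sum_repr, linearForm, mul_comm]

theorem mk_map_mem_zariskiClosure [Finite ι] {κ W' : Type*} [AddCommGroup W'] [Module ℂ W']
    (b : Module.Basis ι ℂ W) (b' : Module.Basis κ ℂ W') {S : Set (ℙ ℂ W)} {T : Set (ℙ ℂ W')}
    (L : W →ₗ[ℂ] W')
    (hST : ∀ w (hw : w ≠ 0) (hLw : L w ≠ 0),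
      Projectivization.mk ℂ w hw ∈ S → Projectivization.mk ℂ (L w) hLw ∈ T)
    {w : W} (hw : w ≠ 0) (hLw : L w ≠ 0)
    (hwS : Projectivization.mk ℂ w hw ∈ zariskiClosure b S) :
    Projectivization.mk ℂ (L w) hLw ∈ zariskiClosure b' T := by
  cases nonempty_fintype ι
  rw [mk_mem_zariskiClosure_iff] at hwS ⊢
  intro d F hF hFT
  obtain ⟨j, hj⟩ : ∃ j, b'.repr (L w) j ≠ 0 := by
    by_contra! h
    exact hLw (b'.repr.map_eq_zero_iff.1 (Finsupp.ext h))
  let coord (i : κ) : MvPolynomial ι ℂ := linearForm b (b'.coord i ∘ₗ L)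
  have heval (v : W) : eval (b.repr v) (aeval coord F) = eval (b'.repr (L v)) F := by
    have h := comp_aeval_apply coord (aeval (b.repr v)) F
    simpa [coord, eval_linearForm] using h
  have hcoord : (coord j).IsHomogeneous 1 := linearForm_isHomogeneous b _
  -- The factor `coord j` takes care of the points of `S` with `L v = 0`, where `hFT` says nothing.
  have hmul := hwS (1 * d + 1) (aeval coord F * coord j)
    ((hF.aeval _ fun i => linearForm_isHomogeneous b _).mul hcoord) ?_
  · rw [map_mul, heval, eval_linearForm] at hmul
    exact (mul_eq_zero.1 hmul).resolve_right hj
  · rintro _ ⟨v, hv, hvS, rfl⟩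
    rw [map_mul, heval, eval_linearForm]
    by_cases hLv : L v = 0
    · simp [hLv]
    · rw [hFT _ ⟨L v, hLv, hST v hv hLv hvS, rfl⟩, zero_mul]

end Cones

/-! ### Decomposable vectors -/

theorem alternatingMap_apply_eq_det_smul {R M N ι : Type*} [CommRing R] [AddCommGroup M]
    [Module R M] [AddCommGroup N] [Module R N] [Fintype ι] [DecidableEq ι]
    (g : M [⋀^ι]→ₗ[R] N) (f : Module.Basis ι R M) (e : ι → M) : g e = f.det e • g f := by
  suffices g = (LinearMap.toSpanSingleton R N (g f)).compAlternatingMap f.det from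
    congrArg (fun h => h e) this
  refine f.ext_alternating fun v hv => ?_
  let σ := Equiv.ofBijective v (Finite.injective_iff_bijective.1 hv)
  change g (f ∘ σ) = f.det (f ∘ σ) • g f
  rw [g.map_perm, f.det.map_perm, f.det_self, Units.smul_def, Units.smul_def, zsmul_one,
    Int.cast_smul_eq_zsmul]

section Field

variable {K M : Type*} [Field K] [AddCommGroup M] [Module K M]

theorem exists_alternatingMap_apply_eq_smul {N ι : Type*} [AddCommGroup N] [Module K N] [Finite ι]
    (g : M [⋀^ι]→ₗ[K] N) {e f : ι → M} (hf : LinearIndependent K f)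
    (h : ∀ i, e i ∈ Submodule.span K (Set.range f)) : ∃ c : K, g e = c • g f := by
  cases nonempty_fintype ι
  classical
  let E := Submodule.span K (Set.range f)
  have hspan := alternatingMap_apply_eq_det_smul (g.compLinearMap E.subtype)
    (Module.Basis.span hf) fun i => ⟨e i, h i⟩
  refine ⟨(Module.Basis.span hf).det fun i => ⟨e i, h i⟩, hspan.trans ?_⟩
  simp only [AlternatingMap.compLinearMap_apply, E, Submodule.subtype_apply,
    Module.Basis.span_apply]

theorem ιMulti_ne_zero_iff {k : ℕ} {e : Fin k → M} :
    exteriorPower.ιMulti K k e ≠ 0 ↔ LinearIndependent K e := by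
  refine ⟨fun h => ?_, fun he => ?_⟩
  · by_contra hdep
    exact h (AlternatingMap.map_linearDependent _ _ hdep)
  · have hne := (exteriorPower.ιMulti_family_linearIndependent_field k he).ne_zero
      (Set.powersetCard.ofFinEmbEquiv (RelEmbedding.refl _))
    simpa [exteriorPower.ιMulti_family] using hne

theorem exists_linearIndependent_append [Module.Finite K M] {r m : ℕ}
    (hM : Module.finrank K M = r + m) {a : Fin r → M} (ha : LinearIndependent K a) :
    ∃ b : Fin m → M, LinearIndependent K (Fin.append a b) := by
  obtain ⟨B, hB⟩ := Submodule.exists_isCompl (Submodule.span K (Set.range a))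
  have hrank := Submodule.finrank_add_eq_of_isCompl hB
  rw [finrank_span_eq_card ha, Fintype.card_fin, hM] at hrank
  let b := Module.finBasisOfFinrankEq K B (by omega : Module.finrank K B = m)
  have hspan : Submodule.span K (Set.range fun i => (b i : M)) ≤ B :=
    Submodule.span_le.2 (Set.range_subset_iff.2 fun i => (b i).2)
  have hsum : LinearIndependent K (Sum.elim a fun i => (b i : M)) :=
    ha.sum_type (b.linearIndependent.map' B.subtype (Submodule.ker_subtype B))
      (hB.disjoint.mono_right hspan)
  refine ⟨fun i => b i, ?_⟩
  rw [← linearIndependent_equiv finSumFinEquiv]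
  convert hsum using 1
  exact Fin.append_comp_sumElim
end Field

/-! ### The parametrization of the restricted secant points -/

/-- Indices of the vectors spanning an `s`-tuple of `(r + m)`-planes with `r` common vectors: first
the common vectors, then `m` further ones for each plane. -/
abbrev RowIdx (r s m : ℕ) : Type := Fin r ⊕ (Fin s × Fin m)

section Parametrization

variable {r s m : ℕ}

/-- The indices of the `r + m` vectors spanning the `i`-th plane. -/
def rowSel (i : Fin s) : Fin (r + m) → RowIdx r s m :=
  Fin.append Sum.inl fun c => Sum.inr (i, c)

@[simp]
theorem rowSel_castAdd (i : Fin s) (l : Fin r) :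
    rowSel (m := m) i (Fin.castAdd m l) = Sum.inl l :=
  Fin.append_left _ _ l

@[simp]
theorem rowSel_natAdd (i : Fin s) (c : Fin m) :
    rowSel (r := r) i (Fin.natAdd r c) = Sum.inr (i, c) :=
  Fin.append_right _ _ c

theorem rowSel_injective (i : Fin s) : Function.Injective (rowSel (r := r) (m := m) i) :=
  Fin.append_injective_iff.2 ⟨Sum.inl_injective,
    Sum.inr_injective.comp (Prod.mk_right_injective i), fun _ _ => Sum.inl_ne_inr⟩

theorem comp_rowSel {M : Type*} (G : RowIdx r s m → M) (i : Fin s) :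
    G ∘ rowSel i = Fin.append (fun l => G (Sum.inl l)) fun c => G (Sum.inr (i, c)) := by
  ext q : 1
  refine Fin.addCases (fun l => ?_) (fun c => ?_) q <;> simp

theorem sumMap_comp_rowSel {s' : ℕ} (σ : Fin s → Fin s') (i : Fin s) :
    Sum.map id (Prod.map σ id) ∘ rowSel (r := r) (m := m) i = rowSel (σ i) :=
  comp_rowSel _ i

/-- The vector `∑ λ_i Ê_i`, where `E_i` is spanned by the vectors `G (rowSel i q)`. -/
def secantVector {R M : Type*} [CommRing R] [AddCommGroup M] [Module R M] (lam : Fin s → R)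
    (G : RowIdx r s m → M) : ⋀[R]^(r + m) M :=
  ∑ i, lam i • exteriorPower.ιMulti R (r + m) (G ∘ rowSel i)

/-- The Plücker coordinate `t` of `∑ λ_i Ê_i`, where `E_i` is spanned by the rows
`G (rowSel i q)`. -/
def plucker {R J : Type*} [CommRing R] (lam : Fin s → R) (G : RowIdx r s m → J → R)
    (t : Fin (r + m) → J) : R :=
  ∑ i, lam i * (Matrix.of fun q q' => G (rowSel i q) (t q')).det

section CommRing

variable {R M M' : Type*} [CommRing R] [AddCommGroup M] [Module R M] [AddCommGroup M'] [Module R M']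

theorem map_secantVector (L : M →ₗ[R] M') (lam : Fin s → R) (G : RowIdx r s m → M) :
    exteriorPower.map (r + m) L (secantVector lam G) = secantVector lam (L ∘ G) := by
  simp [secantVector, exteriorPower.map_apply_ιMulti, Function.comp_assoc]

theorem smul_secantVector (a : R) (lam : Fin s → R) (G : RowIdx r s m → M) :
    a • secantVector lam G = secantVector (a • lam) G := by
  simp [secantVector, Finset.smul_sum, smul_smul]

end CommRing

theorem pluckerBasis_repr_secantVector {n : ℕ} (lam : Fin s → ℂ) (G : RowIdx r s m → V n)
    (S : Set.powersetCard (Fin n) (r + m)) :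
    (pluckerBasis (r + m) n).repr (secantVector lam G) S =
      plucker lam G (Set.powersetCard.ofFinEmbEquiv.symm S) := by
  rw [pluckerBasis, exteriorPower.basis_repr_apply]
  simp only [secantVector, plucker, map_sum, map_smul, exteriorPower.ιMultiDual_apply_ιMulti,
    Pi.basisFun_repr, Module.Basis.coord_apply, smul_eq_mul, Function.comp_apply]

theorem exists_secantVector_eq_of_ne_zero {K M : Type*} [Field K] [AddCommGroup M] [Module K M]
    {lam : Fin s → K} {G : RowIdx r s m → M} (h : secantVector lam G ≠ 0) :
    ∃ (lam' : Fin s → K) (G' : RowIdx r s m → M),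
      (∀ i, LinearIndependent K (G' ∘ rowSel i)) ∧ secantVector lam' G' = secantVector lam G := by
  classical
  obtain ⟨i₀, -, hi₀⟩ := Finset.exists_ne_zero_of_sum_ne_zero h
  have hG₀ : LinearIndependent K (G ∘ rowSel i₀) := ιMulti_ne_zero_iff.1 (right_ne_zero_of_smul hi₀)
  let σ (i : Fin s) : Fin s := if LinearIndependent K (G ∘ rowSel i) then i else i₀
  let lam' (i : Fin s) : K := if LinearIndependent K (G ∘ rowSel i) then lam i else 0
  refine ⟨lam', G ∘ Sum.map id (Prod.map σ id), fun i => ?_, Finset.sum_congr rfl fun i _ => ?_⟩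
  · rw [Function.comp_assoc, sumMap_comp_rowSel]
    by_cases hi : LinearIndependent K (G ∘ rowSel i)
    · simpa only [σ, if_pos hi] using hi
    · simpa only [σ, if_neg hi] using hG₀
  · rw [Function.comp_assoc, sumMap_comp_rowSel]
    by_cases hi : LinearIndependent K (G ∘ rowSel i)
    · simp only [σ, lam', if_pos hi]
    · simp only [lam', if_neg hi, zero_smul, AlternatingMap.map_linearDependent _ _ hi, smul_zero]

theorem mk_secantVector_mem {n : ℕ} (lam : Fin s → ℂ) (G : RowIdx r s m → V n)
    (h : secantVector lam G ≠ 0) :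
    Projectivization.mk ℂ _ h ∈ restrictedSecantPoints (r + m) r s n := by
  obtain ⟨lam', G', hG', heq⟩ := exists_secantVector_eq_of_ne_zero h
  obtain ⟨i₀, -, -⟩ := Finset.exists_ne_zero_of_sum_ne_zero h
  have hne : secantVector lam' G' ≠ 0 := heq ▸ h
  simp only [← heq]
  refine ⟨fun i => Submodule.span ℂ (Set.range (G' ∘ rowSel i)), fun i => _, lam', hne,
    fun i => ⟨_, hG' i, rfl, rfl⟩, ?_, rfl⟩
  have hcommon : LinearIndependent ℂ fun l : Fin r => G' (Sum.inl l) := by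
    simpa [Function.comp_def] using (hG' i₀).comp _ (Fin.castAdd_injective r m)
  have hle : Submodule.span ℂ (Set.range fun l : Fin r => G' (Sum.inl l)) ≤
      ⨅ i, Submodule.span ℂ (Set.range (G' ∘ rowSel i)) :=
    le_iInf fun i => Submodule.span_mono <| Set.range_subset_iff.2 fun l =>
      ⟨Fin.castAdd m l, by simp⟩
  simpa [finrank_span_eq_card hcommon] using Submodule.finrank_mono hle

theorem IsPluckerRep.exists_eq_smul_ιMulti_append {n : ℕ} {E : Submodule ℂ (V n)}
    {ω : ⋀[ℂ]^(r + m) (V n)} (h : IsPluckerRep E ω) {a : Fin r → V n}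
    (ha : LinearIndependent ℂ a) (haE : ∀ l, a l ∈ E) :
    ∃ (b : Fin m → V n) (c : ℂ), ω = c • exteriorPower.ιMulti ℂ (r + m) (Fin.append a b) := by
  obtain ⟨e, he, rfl, rfl⟩ := h
  let E := Submodule.span ℂ (Set.range e)
  have hE : Module.finrank ℂ E = r + m := by
    simpa using finrank_span_eq_card he
  have ha' : LinearIndependent ℂ fun l => (⟨a l, haE l⟩ : E) :=
    LinearIndependent.of_comp E.subtype ha
  obtain ⟨b, hb⟩ := exists_linearIndependent_append hE ha'
  have hspan := hb.span_eq_top_of_card_eq_finrank' (by simp [hE])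
  obtain ⟨c, hc⟩ := exists_alternatingMap_apply_eq_smul
    ((exteriorPower.ιMulti ℂ (r + m)).compLinearMap E.subtype)
    (e := fun q => ⟨e q, Submodule.subset_span ⟨q, rfl⟩⟩) hb (by simp [hspan])
  refine ⟨fun j => b j, c, hc.trans ?_⟩
  rw [AlternatingMap.compLinearMap_apply]
  congr 2
  ext q : 1
  refine Fin.addCases (fun l => ?_) (fun j => ?_) q <;> simp

theorem exists_secantVector_of_mem {n : ℕ} {w : ⋀[ℂ]^(r + m) (V n)} {hw : w ≠ 0}
    (h : Projectivization.mk ℂ w hw ∈ restrictedSecantPoints (r + m) r s n) :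
    ∃ (lam : Fin s → ℂ) (G : RowIdx r s m → V n), w = secantVector lam G := by
  obtain ⟨E, ω, c, hne, hE, hr, hx⟩ := h
  obtain ⟨a, ha⟩ := exists_linearIndependent_of_le_finrank hr
  choose b c' hω using fun i => (hE i).exists_eq_smul_ιMulti_append
    (ha.map' (Submodule.subtype _) (Submodule.ker_subtype _))
    (fun l => (Submodule.mem_iInf _).1 (a l).2 i)
  obtain ⟨μ, hμ⟩ := (Projectivization.mk_eq_mk_iff' ℂ _ _ hw hne).1 hx
  refine ⟨μ • fun i => c i * c' i, Sum.elim (fun l => a l) fun p => b p.1 p.2, ?_⟩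
  rw [← hμ, ← smul_secantVector]
  congr 1
  refine Finset.sum_congr rfl fun i _ => ?_
  rw [hω, smul_smul, comp_rowSel]
  rfl

theorem mem_affineCone_restrictedSecantPoints_iff {n : ℕ}
    {c : Set.powersetCard (Fin n) (r + m) → ℂ} :
    c ∈ affineCone (pluckerBasis (r + m) n) (restrictedSecantPoints (r + m) r s n) ↔
      ∃ (lam : Fin s → ℂ) (G : RowIdx r s m → V n), secantVector lam G ≠ 0 ∧
        c = (pluckerBasis (r + m) n).repr (secantVector lam G) := by
  constructor
  · rintro ⟨w, hw, h, rfl⟩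
    obtain ⟨lam, G, rfl⟩ := exists_secantVector_of_mem h
    exact ⟨lam, G, hw, rfl⟩
  · rintro ⟨lam, G, h, rfl⟩
    exact ⟨_, h, mk_secantVector_mem lam G h, rfl⟩

theorem mk_map_mem_restrictedSecant {n n' : ℕ} (L : V n →ₗ[ℂ] V n')
    {w : ⋀[ℂ]^(r + m) (V n)} {hw : w ≠ 0}
    (h : Projectivization.mk ℂ w hw ∈ restrictedSecant (r + m) r s n)
    (hLw : exteriorPower.map (r + m) L w ≠ 0) :
    Projectivization.mk ℂ _ hLw ∈ restrictedSecant (r + m) r s n' := by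
  refine mk_map_mem_zariskiClosure _ _ _ (fun v hv hLv hmem => ?_) hw hLw h
  obtain ⟨lam, G, rfl⟩ := exists_secantVector_of_mem hmem
  simp only [map_secantVector]
  exact mk_secantVector_mem _ _ _

end Parametrization

/-! ### Contractions -/

section Contraction

variable {R M M' : Type*} [CommRing R] [AddCommGroup M] [Module R M] [AddCommGroup M'] [Module R M']
  {k r s m : ℕ}

/-- The pairing of `w ∈ ⋀ᵏ M` with `φ_1 ∧ ⋯ ∧ φ_k`. -/
def formPairing (w : ⋀[R]^k M) (φ : Fin k → Module.Dual R M) : R :=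
  exteriorPower.alternatingMapToDual R M k φ w

theorem formPairing_map (L : M →ₗ[R] M') (w : ⋀[R]^k M) (φ : Fin k → Module.Dual R M') :
    formPairing (exteriorPower.map k L w) φ = formPairing w fun q => φ q ∘ₗ L := by
  suffices exteriorPower.alternatingMapToDual R M' k φ ∘ₗ exteriorPower.map k L =
      exteriorPower.alternatingMapToDual R M k fun q => φ q ∘ₗ L from LinearMap.congr_fun this w
  apply exteriorPower.linearMap_ext
  ext v
  simp [exteriorPower.map_apply_ιMulti]

theorem formPairing_secantVector (lam : Fin s → R) (G : RowIdx r s m → M)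
    (φ : Fin (r + m) → Module.Dual R M) : formPairing (secantVector lam G) φ =
      ∑ i, lam i * (Matrix.of fun q q' => φ q' (G (rowSel i q))).det := by
  simp [formPairing, secantVector]

theorem eq_of_formPairing_eq [Module.Free R M] {w w' : ⋀[R]^k M}
    (h : ∀ φ, formPairing w φ = formPairing w' φ) : w = w' := by
  classical
  let b := Module.Free.chooseBasis R M
  let _ : LinearOrder (Module.Free.ChooseBasisIndex R M) := linearOrderOfSTO WellOrderingRel
  refine (b.exteriorPower k).ext_elem fun S => ?_
  simpa [exteriorPower.basis_repr_apply, exteriorPower.ιMultiDual, exteriorPower.ιMulti_family,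
    exteriorPower.pairingDual, formPairing] using
      h (b.coord ∘ Set.powersetCard.ofFinEmbEquiv.symm S)

/-- The contraction of `w ∈ ⋀ᵏ M` with linear forms on `M`, in coordinates: the contraction with
`f` has the coordinates `⟨φ_1 ∧ ⋯ ∧ f ∧ ⋯ ∧ φ_k, w⟩`, with `f` in any position `q`. -/
def contraction :
    ⋀[R]^k M →ₗ[R] Module.Dual R M →ₗ[R] (Fin k → Module.Dual R M) × Fin k → R :=
  LinearMap.mk₂ R (fun w f c => formPairing w (Function.update c.1 c.2 f))
    (fun _ _ _ => by ext; simp [formPairing]) (fun _ _ _ => by ext; simp [formPairing])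
    (fun _ _ _ => by ext; simp [formPairing]) (fun _ _ _ => by ext; simp [formPairing])

theorem contraction_apply (w : ⋀[R]^k M) (f : Module.Dual R M)
    (c : (Fin k → Module.Dual R M) × Fin k) :
    contraction w f c = formPairing w (Function.update c.1 c.2 f) := rfl

theorem contraction_map_eq_zero (L : M →ₗ[R] M') (w : ⋀[R]^k M) {f : Module.Dual R M'}
    (hf : f ∘ₗ L = 0) : contraction (exteriorPower.map k L w) f = 0 := by
  ext c
  rw [contraction_apply, formPairing_map, formPairing,
    AlternatingMap.map_coord_zero _ c.2 (by simpa)]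
  rfl

theorem contraction_secantVector_eq_zero (lam : Fin s → R) (G : RowIdx r s m → M)
    {f : Module.Dual R M} (hf : ∀ l, f (G l) = 0) : contraction (secantVector lam G) f = 0 := by
  ext c
  rw [contraction_apply, formPairing_secantVector]
  refine Finset.sum_eq_zero fun i _ => ?_
  rw [Matrix.det_eq_zero_of_column_eq_zero c.2 (by simp [hf]), mul_zero]

theorem map_eq_self_of_contraction_eq_zero [Module.Free R M] {w : ⋀[R]^k M} (P : M →ₗ[R] M)
    (hP : ∀ φ : Module.Dual R M, contraction w (φ ∘ₗ P - φ) = 0) :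
    exteriorPower.map k P w = w := by
  refine eq_of_formPairing_eq fun φ => ?_
  have hdiff := (exteriorPower.alternatingMapToDual R M k).toMultilinearMap
    |>.map_piecewise_sub_map_piecewise (fun q => φ q ∘ₗ P) φ 0 Finset.univ
  simp only [Finset.piecewise_univ, Finset.mem_univ, if_true] at hdiff
  rw [formPairing_map, ← sub_eq_zero]
  refine (LinearMap.congr_fun hdiff w).trans ?_
  rw [LinearMap.sum_apply]
  refine Finset.sum_eq_zero fun q _ => ?_
  let ψ (j : Fin k) : Module.Dual R M := if j < q then φ j ∘ₗ P else φ j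
  have hq : formPairing w (Function.update ψ q (φ q ∘ₗ P - φ q)) = 0 := congrFun (hP (φ q)) (ψ, q)
  convert hq using 2
  rw [formPairing]
  refine congrArg (fun θ => exteriorPower.alternatingMapToDual R M k θ w) (funext fun j => ?_)
  rcases eq_or_ne j q with rfl | hj
  · simp
  · simp [ψ, hj]

end Contraction

/-! ### Orbit stability -/

theorem exists_det_ne_zero_of_linearIndependent {K C : Type*} [Field K] {d : ℕ}
    {v : Fin d → C → K} (hv : LinearIndependent K v) :
    ∃ c : Fin d → C, (Matrix.of fun l l' => v l (c l')).det ≠ 0 := by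
  have hspan := span_flip_eq_top_iff_linearIndependent.2 hv
  have hd : Module.finrank K (Submodule.span K (Set.range (flip v))) = d := by
    rw [hspan, finrank_top, Module.finrank_fin_fun]
  obtain ⟨g, hg, -, hgi⟩ := Submodule.exists_fun_fin_finrank_span_eq K (Set.range (flip v))
  choose c hc using hg
  refine ⟨fun l => c (Fin.cast hd.symm l), ?_⟩
  rw [← Matrix.det_transpose, ← isUnit_iff_ne_zero, ← Matrix.isUnit_iff_isUnit_det,
    ← Matrix.linearIndependent_rows_iff_isUnit]
  obtain rfl : (fun l => flip v (c l)) = g := funext hc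
  exact hgi.comp _ (Fin.cast_injective hd.symm)

theorem det_isHomogeneous {R σ n : Type*} [CommRing R] [Fintype n] [DecidableEq n]
    {A : Matrix n n (MvPolynomial σ R)} (hA : ∀ i j, (A i j).IsHomogeneous 1) :
    A.det.IsHomogeneous (Fintype.card n) := by
  rw [Matrix.det_apply]
  refine MvPolynomial.IsHomogeneous.sum _ _ _ fun τ _ => ?_
  have hprod : (∏ i, A (τ i) i).IsHomogeneous (Fintype.card n) := by
    simpa using MvPolynomial.IsHomogeneous.prod Finset.univ _ (fun _ => 1) fun i _ => hA (τ i) i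
  rcases Int.units_eq_one_or (Equiv.Perm.sign τ) with h | h
  · simpa [h] using hprod
  · simpa [h] using hprod.neg

theorem finrank_range_le_of_mem_zariskiClosure {ι W D C : Type*} [Finite ι] [AddCommGroup W]
    [Module ℂ W] [AddCommGroup D] [Module ℂ D] [Module.Finite ℂ D] (b : Module.Basis ι ℂ W)
    (B : W →ₗ[ℂ] D →ₗ[ℂ] C → ℂ) {S : Set (ℙ ℂ W)} {N : ℕ}
    (hS : ∀ v (hv : v ≠ 0), Projectivization.mk ℂ v hv ∈ S →
      Module.finrank ℂ (LinearMap.range (B v)) ≤ N)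
    {w : W} {hw : w ≠ 0} (h : Projectivization.mk ℂ w hw ∈ zariskiClosure b S) :
    Module.finrank ℂ (LinearMap.range (B w)) ≤ N := by
  cases nonempty_fintype ι
  by_contra! hlt
  obtain ⟨u, hu⟩ := exists_linearIndependent_of_le_finrank (Nat.succ_le_of_lt hlt)
  choose f hf using fun l => (u l).2
  have hBf : LinearIndependent ℂ fun l => B w (f l) := by
    rw [show (fun l => B w (f l)) = Submodule.subtype _ ∘ u from funext hf]
    exact hu.map' (Submodule.subtype _) (Submodule.ker_subtype _)
  obtain ⟨c, hc⟩ := exists_det_ne_zero_of_linearIndependent hBf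
  let A : Matrix (Fin N.succ) (Fin N.succ) (MvPolynomial ι ℂ) := Matrix.of fun l l' =>
    linearForm b (LinearMap.proj (c l') ∘ₗ B.flip (f l))
  have heval (v : W) : MvPolynomial.eval (b.repr v) A.det =
      (Matrix.of fun l l' => B v (f l) (c l')).det := by
    rw [RingHom.map_det]
    congr 1
    ext l l'
    simp [A, eval_linearForm]
  rw [mk_mem_zariskiClosure_iff] at h
  refine hc ((heval w).symm.trans
    (h _ A.det (det_isHomogeneous fun l l' => linearForm_isHomogeneous b _) ?_))
  rintro _ ⟨v, hv, hvS, rfl⟩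
  rw [heval]
  by_contra hdet
  have hrows := Matrix.linearIndependent_rows_iff_isUnit.2
    ((Matrix.isUnit_iff_isUnit_det _).2 (isUnit_iff_ne_zero.2 hdet))
  have hBv : LinearIndependent ℂ fun l => B v (f l) :=
    LinearIndependent.of_comp (LinearMap.funLeft ℂ ℂ c) hrows
  have hrange : LinearIndependent ℂ fun l => (B v).rangeRestrict (f l) :=
    LinearIndependent.of_comp (LinearMap.range (B v)).subtype hBv
  have hcard := hrange.fintype_card_le_finrank.trans (hS v hv hvS)
  simp at hcard

variable {r s m : ℕ}

theorem finrank_range_contraction_secantVector_le {K M : Type*} [Field K] [AddCommGroup M]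
    [Module K M] [Module.Finite K M] (lam : Fin s → K) (G : RowIdx r s m → M) :
    Module.finrank K (LinearMap.range (contraction (secantVector lam G))) ≤ r + s * m := by
  let evalG : Module.Dual K M →ₗ[K] RowIdx r s m → K :=
    LinearMap.pi fun l => Module.Dual.eval K M (G l)
  have hker : LinearMap.ker evalG ≤ LinearMap.ker (contraction (secantVector lam G)) :=
    fun f hf => contraction_secantVector_eq_zero lam G fun l => congrFun hf l
  have hrange : Module.finrank K (LinearMap.range evalG) ≤ r + s * m := by
    simpa using Submodule.finrank_le (LinearMap.range evalG)
  have hle := Submodule.finrank_mono hker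
  have h₁ := LinearMap.finrank_range_add_finrank_ker evalG
  have h₂ := LinearMap.finrank_range_add_finrank_ker (contraction (secantVector lam G))
  omega

theorem finrank_range_contraction_le {n : ℕ} {w : ⋀[ℂ]^(r + m) (V n)} {hw : w ≠ 0}
    (h : Projectivization.mk ℂ w hw ∈ restrictedSecant (r + m) r s n) :
    Module.finrank ℂ (LinearMap.range (contraction w)) ≤ r + s * m := by
  refine finrank_range_le_of_mem_zariskiClosure _ contraction (fun v hv hmem => ?_) h
  obtain ⟨lam, G, rfl⟩ := exists_secantVector_of_mem hmem
  exact finrank_range_contraction_secantVector_le lam G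

theorem exists_le_range_equiv_comp {K M M' : Type*} [Field K] [AddCommGroup M] [Module K M]
    [AddCommGroup M'] [Module K M'] {L : M →ₗ[K] M'} (hL : Function.Injective L)
    {U : Submodule K M'} [Module.Finite K U] (hU : Module.finrank K U ≤ Module.finrank K M) :
    ∃ g : M' ≃ₗ[K] M', U ≤ LinearMap.range (g.toLinearMap ∘ₗ L) := by
  obtain ⟨v, hv⟩ := exists_linearIndependent_of_le_finrank hU
  let T : U →ₗ[K] M := (Module.finBasis K U).constr K v
  have hT : Function.Injective T := (Module.finBasis K U).injective_constr_of_linearIndependent hv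
  obtain ⟨g, hg⟩ := Submodule.exists_linearEquiv_restrict_eq
    (LinearEquiv.ofInjective (L ∘ₗ T) (hL.comp hT))
  refine ⟨g.symm, fun x hx => ⟨T ⟨x, hx⟩, ?_⟩⟩
  exact g.symm_apply_eq.2 (hg ⟨x, hx⟩)

theorem orbitStableAt (r s m : ℕ) : OrbitStableAt (r + m) r s (r + s * m) := by
  intro i j hij hi
  apply Set.Subset.antisymm
  · rintro _ ⟨g, y, hy, rfl⟩
    induction y using Projectivization.ind with
    | h v hv =>
      rw [Projectivization.map_mk]
      exact mk_map_mem_restrictedSecant _ hy _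
  · intro x hx
    induction x using Projectivization.ind with
    | h w hw =>
      let K := LinearMap.ker (contraction w)
      have hU : Module.finrank ℂ K.dualCoannihilator ≤ i := by
        have hrank := LinearMap.finrank_range_add_finrank_ker (contraction w)
        have hcoann := Subspace.finrank_add_finrank_dualCoannihilator_eq K
        rw [Subspace.dual_finrank_eq, ← hcoann, add_comm] at hrank
        exact (Nat.add_left_cancel hrank).ge.trans ((finrank_range_contraction_le hx).trans hi)
      obtain ⟨g, hg⟩ := exists_le_range_equiv_comp (incl_injective hij)
        (hU.trans (Module.finrank_fin_fun ℂ).ge)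
      obtain ⟨L, hL⟩ := (g.toLinearMap ∘ₗ incl hij).exists_leftInverse_of_injective
        (LinearMap.ker_eq_bot.2 (g.injective.comp (incl_injective hij)))
      have hw_eq : exteriorPower.map (r + m) ((g.toLinearMap ∘ₗ incl hij) ∘ₗ L) w = w := by
        refine map_eq_self_of_contraction_eq_zero _ fun φ => LinearMap.mem_ker.1 ?_
        rw [← Subspace.dualCoannihilator_dualAnnihilator_eq (W := LinearMap.ker (contraction w)),
          Submodule.mem_dualAnnihilator]
        intro u hu
        obtain ⟨v, rfl⟩ := hg hu
        have hLv := LinearMap.congr_fun hL v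
        rw [LinearMap.comp_apply, LinearMap.id_apply] at hLv
        rw [LinearMap.sub_apply, LinearMap.comp_apply, LinearMap.comp_apply, hLv, sub_self]
      rw [exteriorPower.map_comp, LinearMap.comp_apply] at hw_eq
      have hLw : exteriorPower.map (r + m) L w ≠ 0 := fun h0 =>
        hw (by rw [← hw_eq, h0, map_zero])
      refine ⟨g, _, mk_map_mem_restrictedSecant L hx hLw, ?_⟩
      simp only [Projectivization.map_mk, hw_eq]

/-! ### The first step of orbit stability -/

theorem exists_rowSel_eq (hs : 1 ≤ s) (l : RowIdx r s m) :
    ∃ (i : Fin s) (q : Fin (r + m)), rowSel i q = l := by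
  rcases l with l | ⟨i, c⟩
  · exact ⟨⟨0, hs⟩, Fin.castAdd m l, rowSel_castAdd _ _⟩
  · exact ⟨i, Fin.natAdd r c, rowSel_natAdd _ _⟩

theorem rowSel_ne_natAdd {i i' : Fin s} (hi : i' ≠ i) (q : Fin (r + m)) (c : Fin m) :
    rowSel i' q ≠ rowSel i (Fin.natAdd r c) := by
  refine Fin.addCases (fun l => ?_) (fun c' => ?_) q <;> simp [hi]

theorem contraction_secantVector_basis {R M : Type*} [CommRing R] [AddCommGroup M] [Module R M]
    (hgen : s = 1 ∨ 2 ≤ m) (G : Module.Basis (RowIdx r s m) R M) (f : Module.Dual R M)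
    (i : Fin s) (q : Fin (r + m)) :
    contraction (secantVector (1 : Fin s → R) G) f (fun p => G.coord (rowSel i p), q) =
      f (G (rowSel i q)) := by
  rw [contraction_apply, formPairing_secantVector, Finset.sum_eq_single i]
  · have : (Matrix.of fun p p' =>
        Function.update (fun p => G.coord (rowSel i p)) q f p' (G (rowSel i p))) =
        Matrix.updateCol 1 q fun p => f (G (rowSel i p)) := by
      ext p p'
      rcases eq_or_ne p' q with rfl | hp
      · simp
      · simp [hp, Matrix.one_apply, Finsupp.single_apply, (rowSel_injective i).eq_iff]
    rw [this, ← Matrix.cramer_apply, Matrix.cramer_one]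
    simp
  · intro i' _ hi'
    have hm : 2 ≤ m := hgen.resolve_left fun hs => hi' (by subst hs; exact Subsingleton.elim _ _)
    have : Nontrivial (Fin m) := Fin.nontrivial_iff_two_le.2 hm
    obtain ⟨c, hc⟩ : ∃ c : Fin m, Fin.natAdd r c ≠ q := by
      by_contra! hall
      obtain ⟨c, c', hcc⟩ := exists_pair_ne (Fin m)
      exact hcc (Fin.natAdd_injective _ _ ((hall c).trans (hall c').symm))
    rw [Matrix.det_eq_zero_of_column_eq_zero (Fin.natAdd r c), mul_zero]
    intro p
    simpa [hc, Finsupp.single_apply] using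
      fun h => (rowSel_ne_natAdd hi' p c (by simpa using h)).elim
  · simp

theorem contraction_secantVector_basis_injective {R M : Type*} [CommRing R] [AddCommGroup M]
    [Module R M] (hs : 1 ≤ s) (hgen : s = 1 ∨ 2 ≤ m) (G : Module.Basis (RowIdx r s m) R M) :
    Function.Injective (contraction (secantVector (1 : Fin s → R) G)) := by
  refine (injective_iff_map_eq_zero _).2 fun f hf => G.ext fun l => ?_
  obtain ⟨i, q, rfl⟩ := exists_rowSel_eq hs l
  rw [← contraction_secantVector_basis hgen, hf]
  rfl

theorem not_orbitStableAt {q : ℕ} (hs : 1 ≤ s) (hgen : s = 1 ∨ 2 ≤ m) (hq : q < r + s * m) :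
    ¬ OrbitStableAt (r + m) r s q := by
  intro hstab
  let G : Module.Basis (RowIdx r s m) ℂ (V (r + s * m)) :=
    (Pi.basisFun ℂ _).reindex (Fintype.equivFinOfCardEq (by simp)).symm
  have hinj := contraction_secantVector_basis_injective hs hgen G
  have exists_form (L : V q →ₗ[ℂ] V (r + s * m)) : ∃ f : Module.Dual ℂ (V (r + s * m)),
      f ≠ 0 ∧ f ∘ₗ L = 0 := by
    have hlt : LinearMap.range L < ⊤ := lt_top_iff_ne_top.2 fun htop => by
      have := L.finrank_range_le
      rw [htop, finrank_top, Module.finrank_fin_fun, Module.finrank_fin_fun] at this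
      omega
    obtain ⟨f, hf, hle⟩ := Submodule.exists_le_ker_of_lt_top _ hlt
    exact ⟨f, hf, LinearMap.range_le_ker_iff.1 hle⟩
  have hne : secantVector 1 G ≠ 0 := fun h0 => by
    obtain ⟨f, hf, -⟩ := exists_form 0
    exact hf (hinj (by rw [map_zero, h0, map_zero, LinearMap.zero_apply]))
  have hmem := subset_zariskiClosure (pluckerBasis _ _) _ (mk_secantVector_mem 1 G hne)
  obtain ⟨g, y, -, hy⟩ := (hstab q _ hq.le le_rfl).ge hmem
  induction y using Projectivization.ind with
  | h v hv =>
    rw [Projectivization.map_mk, Projectivization.mk_eq_mk_iff'] at hy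
    obtain ⟨a, ha⟩ := hy
    obtain ⟨f, hf, hfL⟩ := exists_form (g.toLinearMap ∘ₗ incl hq.le)
    refine hf (hinj ?_)
    rw [← ha, map_smul, LinearMap.smul_apply, contraction_map_eq_zero _ _ hfL, smul_zero, map_zero]

/-! ### Coordinate rings and generic Plücker coordinates -/

section Plucker

variable {K R R' J : Type*} [CommRing R] [CommRing R']

theorem map_plucker (φ : R →+* R') (lam : Fin s → R) (G : RowIdx r s m → J → R)
    (t : Fin (r + m) → J) :
    φ (plucker lam G t) = plucker (fun i => φ (lam i)) (fun l j => φ (G l j)) t := by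
  simp only [plucker, map_sum, map_mul, RingHom.map_det]
  rfl

theorem plucker_comp_perm (lam : Fin s → R) (G : RowIdx r s m → J → R) (t : Fin (r + m) → J)
    (τ : Equiv.Perm (Fin (r + m))) :
    plucker lam G (t ∘ τ) = Equiv.Perm.sign τ * plucker lam G t := by
  simp only [plucker, Finset.mul_sum]
  refine Finset.sum_congr rfl fun i _ => ?_
  rw [mul_left_comm, ← Matrix.det_permute']
  rfl

theorem plucker_eq_zero_of_not_injective (lam : Fin s → R) (G : RowIdx r s m → J → R)
    {t : Fin (r + m) → J} (ht : ¬ Function.Injective t) : plucker lam G t = 0 := by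
  simp only [Function.Injective, not_forall] at ht
  obtain ⟨q, q', htq, hne⟩ := ht
  refine Finset.sum_eq_zero fun i _ => ?_
  rw [Matrix.det_zero_of_column_eq hne (by simp [htq]), mul_zero]

theorem exists_plucker_eq (hs : 1 ≤ s) {t : Fin (r + m) → J} (ht : Function.Injective t) (a : R) :
    ∃ (lam : Fin s → R) (G : RowIdx r s m → J → R), plucker lam G t = a := by
  classical
  let π : RowIdx r s m → Fin (r + m) := Sum.elim (Fin.castAdd m) fun p => Fin.natAdd r p.2
  have hπ (i : Fin s) (q : Fin (r + m)) : π (rowSel i q) = q := by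
    refine Fin.addCases (fun l => ?_) (fun c => ?_) q <;> simp [π]
  refine ⟨Pi.single ⟨0, hs⟩ a, fun l j => if t (π l) = j then 1 else 0, ?_⟩
  have hone : (Matrix.of fun q q' : Fin (r + m) => if t q = t q' then (1 : R) else 0) = 1 := by
    ext q q'
    simp [Matrix.one_apply, ht.eq_iff]
  simp [plucker, hπ, hone]

variable [CommRing K] [Algebra K R]

variable (K) in
/-- The subalgebra generated by the Plücker coordinates of `∑ λ_i Ê_i`. -/
def pluckerAlgebra (lam : Fin s → R) (G : RowIdx r s m → J → R) : Subalgebra K R :=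
  Algebra.adjoin K (Set.range (plucker lam G))

theorem plucker_mem_pluckerAlgebra (lam : Fin s → R) (G : RowIdx r s m → J → R)
    (t : Fin (r + m) → J) : plucker lam G t ∈ pluckerAlgebra K lam G :=
  Algebra.subset_adjoin ⟨t, rfl⟩

theorem finiteType_pluckerAlgebra [Finite J] (lam : Fin s → R) (G : RowIdx r s m → J → R) :
    Algebra.FiniteType K (pluckerAlgebra K lam G) :=
  (Subalgebra.fg_iff_finiteType _).1 <| Subalgebra.fg_def.2 ⟨_, Set.finite_range _, rfl⟩

theorem adjoin_range_plucker_powersetCard {n : ℕ} (e : Fin n ≃ J) (lam : Fin s → R)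
    (G : RowIdx r s m → J → R) :
    Algebra.adjoin K (Set.range fun S : Set.powersetCard (Fin n) (r + m) =>
      plucker lam G (e ∘ Set.powersetCard.ofFinEmbEquiv.symm S)) = pluckerAlgebra K lam G := by
  refine le_antisymm (Algebra.adjoin_mono (Set.range_subset_iff.2 fun S => ⟨_, rfl⟩))
    (Algebra.adjoin_le (Set.range_subset_iff.2 fun t => ?_))
  by_cases ht : Function.Injective t
  · let τ := Tuple.sort (e.symm ∘ t)
    have hτ : StrictMono ((e.symm ∘ t) ∘ τ) := (Tuple.monotone_sort _).strictMono_of_injective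
      ((e.symm.injective.comp ht).comp τ.injective)
    have hcomp : t = (e ∘ ((e.symm ∘ t) ∘ τ)) ∘ τ.symm := by
      ext q
      simp
    rw [hcomp, plucker_comp_perm]
    refine mul_mem (intCast_mem _ _) (Algebra.subset_adjoin
      ⟨Set.powersetCard.ofFinEmbEquiv (OrderEmbedding.ofStrictMono _ hτ), ?_⟩)
    simp only [Equiv.symm_apply_apply]
    rfl
  · rw [plucker_eq_zero_of_not_injective lam G ht]
    exact zero_mem _

variable (s K) in
/-- The Plücker coordinate `t` of `∑ λ_i Ê_i`, where the `λ_i` and the coordinates of the vectors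
spanning the `E_i` are indeterminates. -/
def genericPlucker (t : Fin (r + m) → J) : MvPolynomial (Fin s ⊕ RowIdx r s m × J) K :=
  plucker (fun i => MvPolynomial.X (Sum.inl i)) (fun l j => MvPolynomial.X (Sum.inr (l, j))) t

theorem aeval_genericPlucker (z : Fin s ⊕ RowIdx r s m × J → R) (t : Fin (r + m) → J) :
    MvPolynomial.aeval z (genericPlucker s K t) =
      plucker (fun i => z (Sum.inl i)) (fun l j => z (Sum.inr (l, j))) t := by
  rw [genericPlucker, ← AlgHom.coe_toRingHom, map_plucker]
  simp

theorem eval_genericPlucker (z : Fin s ⊕ RowIdx r s m × J → K) (t : Fin (r + m) → J) :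
    MvPolynomial.eval z (genericPlucker s K t) =
      plucker (fun i => z (Sum.inl i)) (fun l j => z (Sum.inr (l, j))) t := by
  rw [← MvPolynomial.aeval_eq_eval, aeval_genericPlucker]

theorem exists_eval_genericPlucker_eq (hs : 1 ≤ s) {t : Fin (r + m) → J}
    (ht : Function.Injective t) (a : K) :
    ∃ z, MvPolynomial.eval z (genericPlucker s K t) = a := by
  obtain ⟨lam, G, h⟩ := exists_plucker_eq hs ht a
  exact ⟨Sum.elim lam fun p => G p.1 p.2, by rw [eval_genericPlucker]; exact h⟩

theorem transcendental_genericPlucker [IsDomain K] [Infinite K] (hs : 1 ≤ s)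
    {t : Fin (r + m) → J} (ht : Function.Injective t) :
    Transcendental K (genericPlucker s K t) := by
  rintro ⟨p, hp, hpt⟩
  refine hp (Polynomial.funext fun a => ?_)
  obtain ⟨z, rfl⟩ := exists_eval_genericPlucker_eq hs ht a
  have := congrArg (MvPolynomial.aeval (R := K) z) hpt
  rw [← Polynomial.aeval_algHom_apply, map_zero] at this
  simpa using this

/-- Every point outside the zero locus of a nonzero polynomial has the Plücker coordinates of some
specialization of `(lam, G)`. This encodes that the family `∑ λ_i Ê_i` given by `(lam, G)`
parametrizes a dense set of secant vectors. -/
def IsDominant (K : Type*) [CommRing K] [Algebra K R] (lam : Fin s → R)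
    (G : RowIdx r s m → J → R) : Prop :=
  ∃ g : MvPolynomial (Fin s ⊕ RowIdx r s m × J) K, g ≠ 0 ∧
    ∀ z, MvPolynomial.eval z g ≠ 0 → ∃ φ : R →ₐ[K] K, ∀ t : Fin (r + m) → J,
      MvPolynomial.eval z (genericPlucker s K t) = φ (plucker lam G t)

variable (r s m K J) in
/-- The subalgebra generated by the Plücker coordinates of the generic secant vector. -/
abbrev genericPluckerAlgebra : Subalgebra K (MvPolynomial (Fin s ⊕ RowIdx r s m × J) K) :=
  pluckerAlgebra K (fun i => MvPolynomial.X (Sum.inl i)) fun l j => MvPolynomial.X (Sum.inr (l, j))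

theorem IsDominant.generic [Nontrivial K] : IsDominant K
    (fun i : Fin s => (MvPolynomial.X (Sum.inl i) : MvPolynomial (Fin s ⊕ RowIdx r s m × J) K))
    fun l j => MvPolynomial.X (Sum.inr (l, j)) :=
  ⟨1, one_ne_zero, fun z _ => ⟨MvPolynomial.aeval z, fun t => by
    rw [← MvPolynomial.aeval_eq_eval]; rfl⟩⟩

theorem IsDominant.ker_aeval_plucker {ι : Type*} [IsDomain K] [Infinite K] {lam : Fin s → R}
    {G : RowIdx r s m → J → R} (h : IsDominant K lam G) (t : ι → Fin (r + m) → J) :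
    RingHom.ker (MvPolynomial.aeval (R := K) fun S => plucker lam G (t S)) =
      RingHom.ker (MvPolynomial.aeval (R := K) fun S => genericPlucker s K (t S)) := by
  obtain ⟨g, hg, hφ⟩ := h
  ext F
  rw [RingHom.mem_ker, RingHom.mem_ker]
  refine ⟨fun hF => ?_, fun hF => ?_⟩
  · refine eq_zero_of_eval_eq_zero_of_eval_ne_zero hg fun z hz => ?_
    obtain ⟨φ, hφ⟩ := hφ z hz
    calc MvPolynomial.eval z (MvPolynomial.aeval (fun S => genericPlucker s K (t S)) F)
        = MvPolynomial.aeval (fun S => MvPolynomial.eval z (genericPlucker s K (t S))) F := by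
          simp only [← MvPolynomial.aeval_eq_eval, MvPolynomial.comp_aeval_apply]
      _ = φ (MvPolynomial.aeval (fun S => plucker lam G (t S)) F) := by
          simp only [hφ, MvPolynomial.comp_aeval_apply]
      _ = 0 := by rw [hF, map_zero]
  · let ev := MvPolynomial.aeval (R := K) (Sum.elim lam fun p : RowIdx r s m × J => G p.1 p.2)
    have hev (S : ι) : ev (genericPlucker s K (t S)) = plucker lam G (t S) :=
      aeval_genericPlucker _ _
    simp only [← hev]
    rw [← MvPolynomial.comp_aeval_apply, hF, map_zero]

end Plucker

theorem vanishingIdeal_affineCone_restrictedSecantPoints {n : ℕ} {J : Type*} (e : Fin n ≃ J)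
    (hs : 1 ≤ s) (hn : r + m ≤ n) :
    MvPolynomial.vanishingIdeal ℂ
        (affineCone (pluckerBasis (r + m) n) (restrictedSecantPoints (r + m) r s n)) =
      RingHom.ker (MvPolynomial.aeval (R := ℂ) fun S : Set.powersetCard (Fin n) (r + m) =>
        genericPlucker s ℂ (e ∘ Set.powersetCard.ofFinEmbEquiv.symm S)) := by
  let t (S : Set.powersetCard (Fin n) (r + m)) := Set.powersetCard.ofFinEmbEquiv.symm S
  let Ψ (S : Set.powersetCard (Fin n) (r + m)) := genericPlucker s ℂ (e ∘ t S)
  have heval (z) (F : MvPolynomial (Set.powersetCard (Fin n) (r + m)) ℂ) :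
      MvPolynomial.eval z (MvPolynomial.aeval Ψ F) =
        MvPolynomial.eval ((pluckerBasis (r + m) n).repr
          (secantVector (fun i => z (Sum.inl i)) fun l j => z (Sum.inr (l, e j)))) F := by
    rw [← MvPolynomial.aeval_eq_eval, MvPolynomial.comp_aeval_apply, MvPolynomial.aeval_eq_eval,
      MvPolynomial.aeval_eq_eval]
    congr 2
    ext S
    rw [pluckerBasis_repr_secantVector, eval_genericPlucker]
    rfl
  ext F
  rw [MvPolynomial.mem_vanishingIdeal_iff, RingHom.mem_ker]
  simp only [MvPolynomial.aeval_eq_eval]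
  refine ⟨fun hF => ?_, fun hF c hc => ?_⟩
  · let S : Set.powersetCard (Fin n) (r + m) :=
      Set.powersetCard.ofFinEmbEquiv (Fin.castLEOrderEmb hn)
    obtain ⟨z₀, hz₀⟩ := exists_eval_genericPlucker_eq (K := ℂ) hs
      (e.injective.comp (t S).injective) 1
    have hΨ : Ψ S ≠ 0 := fun h => by
      simp [show genericPlucker s ℂ (e ∘ t S) = 0 from h] at hz₀
    refine eq_zero_of_eval_eq_zero_of_eval_ne_zero hΨ fun z hz => ?_
    rw [heval]
    refine hF _ (mem_affineCone_restrictedSecantPoints_iff.2 ⟨_, _, fun h0 => hz ?_, rfl⟩)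
    have := heval z (MvPolynomial.X S)
    simpa [h0] using this
  · obtain ⟨lam, G, -, rfl⟩ := mem_affineCone_restrictedSecantPoints_iff.1 hc
    have := heval (Sum.elim lam fun p => G p.1 (e.symm p.2)) F
    simpa only [Ψ, t, hF, map_zero, Sum.elim_inl, Sum.elim_inr, Equiv.symm_apply_apply]
      using this.symm

theorem IsDominant.ringKrullDim_restrictedSecantPoints {n : ℕ} {J P : Type*} [CommRing P]
    [IsDomain P] [Algebra ℂ P] {lam : Fin s → P} {G : RowIdx r s m → J → P}
    (h : IsDominant ℂ lam G) (e : Fin n ≃ J) (hs : 1 ≤ s) (hn : r + m ≤ n) :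
    ringKrullDim (CoordinateRing (pluckerBasis (r + m) n)
      (restrictedSecantPoints (r + m) r s n)) =
        (Algebra.trdeg ℂ (pluckerAlgebra ℂ lam G)).toNat := by
  have : Finite J := Finite.of_equiv _ e
  have := finiteType_pluckerAlgebra (K := ℂ) lam G
  unfold CoordinateRing
  rw [vanishingIdeal_affineCone_restrictedSecantPoints e hs hn,
    ← h.ker_aeval_plucker, ringKrullDim_eq_of_ringEquiv
      (Ideal.quotientKerEquivRange (MvPolynomial.aeval (R := ℂ) _)).toRingEquiv,
    ← Algebra.adjoin_range_eq_range_aeval, adjoin_range_plucker_powersetCard,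
    ringKrullDim_eq_toNat_trdeg ℂ]

theorem trdeg_pluckerAlgebra_lt_aleph0 {K R J : Type*} [Field K] [CommRing R] [Algebra K R]
    [Finite J] (lam : Fin s → R) (G : RowIdx r s m → J → R) :
    Algebra.trdeg K (pluckerAlgebra K lam G) < Cardinal.aleph0 :=
  have := finiteType_pluckerAlgebra (K := K) lam G
  trdeg_lt_aleph0_of_finiteType

theorem trdeg_genericPluckerAlgebra_ne_zero {K J : Type*} [Field K] [Infinite K] (hs : 1 ≤ s)
    {t : Fin (r + m) → J} (ht : Function.Injective t) :
    Algebra.trdeg K (genericPluckerAlgebra r s m K J) ≠ 0 := by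
  rw [Ne, trdeg_eq_zero_iff]
  rintro ⟨h⟩
  exact transcendental_genericPlucker hs ht
    ((h ⟨_, plucker_mem_pluckerAlgebra _ _ t⟩).algHom (Subalgebra.val _))

/-! ### Secant vectors of a variable subspace -/

theorem trdeg_eq_of_le_of_isAlgebraic {K P : Type*} [Field K] [CommRing P] [IsDomain P]
    [Algebra K P] {A B : Subalgebra K P} (hAB : A ≤ B) (h : ∀ b ∈ B, IsAlgebraic A b) :
    Algebra.trdeg K A = Algebra.trdeg K B := by
  let := (Subalgebra.inclusion hAB).toAlgebra
  have : IsScalarTower K A B := IsScalarTower.of_algebraMap_eq fun _ => rfl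
  have : IsScalarTower A B P := IsScalarTower.of_algebraMap_eq fun _ => rfl
  have : FaithfulSMul A B :=
    (faithfulSMul_iff_algebraMap_injective _ _).2 (Subalgebra.inclusion_injective hAB)
  have : Algebra.IsAlgebraic A B := ⟨fun b => by
    rw [← isAlgebraic_algHom_iff (IsScalarTower.toAlgHom A B P) Subtype.val_injective]
    exact h b b.2⟩
  rw [← trdeg_add_eq K A (A := B), trdeg_eq_zero (R := A) (A := B), add_zero]

theorem isAlgebraic_of_mulVec_mem {K P N : Type*} [CommRing K] [CommRing P] [IsDomain P]
    [Algebra K P] [Fintype N] [DecidableEq N] {A : Subalgebra K P} {U : Matrix N N A} {x : N → P}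
    (hU : U.det ≠ 0) (hx : ∀ l, (U.map A.val).mulVec x l ∈ A) (j : N) : IsAlgebraic A (x j) := by
  let w (l : N) : A := ⟨_, hx l⟩
  have cramer : (U.map A.val).det * x j = (U.adjugate.mulVec w j : A) := calc
    (U.map A.val).det * x j
        = ((U.map A.val).adjugate.mulVec ((U.map A.val).mulVec x)) j := by
      rw [Matrix.mulVec_mulVec, Matrix.adjugate_mul, Matrix.smul_mulVec, Matrix.one_mulVec]
      rfl
    _ = ((A.val.toRingHom.mapMatrix U.adjugate).mulVec (A.val ∘ w)) j := by
      rw [RingHom.map_adjugate]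
      rfl
    _ = A.val (U.adjugate.mulVec w j) := (RingHom.map_mulVec A.val.toRingHom U.adjugate w j).symm
  have hdet : (U.map A.val).det = (U.det : A) := (RingHom.map_det A.val.toRingHom U).symm
  rw [hdet] at cramer
  refine IsAlgebraic.of_mul (y := ((U.det : A) : P))
    (mem_nonZeroDivisors_of_ne_zero fun h => hU (Subtype.ext h))
    (isAlgebraic_algebraMap U.det) ?_
  rw [cramer]
  exact isAlgebraic_algebraMap (U.adjugate.mulVec w j)

section Plucker

variable {R J : Type*} [CommRing R]

theorem plucker_update_eq_sum {L : Type*} [Fintype L] (lam : Fin s → R)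
    (G : RowIdx r s m → J → R) (t : Fin (r + m) → J) (q : Fin (r + m)) {j : J} {x : L → R}
    {c : L → J} (h : ∀ l, G l j = ∑ l', x l' * G l (c l')) :
    plucker lam G (Function.update t q j) =
      ∑ l', x l' * plucker lam G (Function.update t q (c l')) := by
  simp only [plucker, Finset.mul_sum]
  rw [Finset.sum_comm]
  refine Finset.sum_congr rfl fun i _ => ?_
  have hcol (j' : J) :
      (Matrix.of fun q₁ q₂ => G (rowSel i q₁) (Function.update t q j' q₂)).det =
        (Matrix.of fun q₁ q₂ => G (rowSel i q₁) (t q₂)).cramer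
          (fun q₁ => G (rowSel i q₁) j') q := by
    rw [Matrix.cramer_apply]
    congr 1
    ext q₁ q₂
    rcases eq_or_ne q₂ q with rfl | hq
    · simp
    · simp [hq]
  have hx : (fun q₁ => G (rowSel i q₁) j) = ∑ l', x l' • fun q₁ => G (rowSel i q₁) (c l') := by
    ext q₁
    simp [h]
  simp only [hcol]
  rw [hx, map_sum, Finset.sum_apply, Finset.mul_sum]
  simp only [map_smul, Pi.smul_apply, smul_eq_mul, mul_left_comm]

theorem plucker_eq_sum {L : Type*} [Fintype L] (lam : Fin s → R) {G : RowIdx r s m → J → R}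
    {G₀ : RowIdx r s m → L → R} {y : L → J → R} (h : ∀ l j, G l j = ∑ l', y l' j * G₀ l l')
    (t : Fin (r + m) → J) :
    plucker lam G t = ∑ f : Fin (r + m) → L, (∏ q, y (f q) (t q)) * plucker lam G₀ f := by
  classical
  simp only [plucker, Finset.mul_sum]
  rw [Finset.sum_comm]
  refine Finset.sum_congr rfl fun i _ => ?_
  have hdet (H : RowIdx r s m → Fin (r + m) → R) :
      (Matrix.of fun q q' => H (rowSel i q) q').det =
        Matrix.detRowAlternating.toMultilinearMap fun q' q => H (rowSel i q) q' :=
    (Matrix.det_transpose _).symm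
  have hG : (fun q' q => G (rowSel i q) (t q')) =
      fun q' => ∑ l', y l' (t q') • fun q => G₀ (rowSel i q) l' := by
    ext q' q
    simp [h]
  rw [hdet fun l q' => G l (t q'), hG, MultilinearMap.map_sum, Finset.mul_sum]
  refine Finset.sum_congr rfl fun f _ => ?_
  rw [MultilinearMap.map_smul_univ, hdet fun l q' => G₀ l (f q'), smul_eq_mul, mul_left_comm]

theorem plucker_one_single_update_rowSel (hgen : s = 1 ∨ 2 ≤ m) (i : Fin s) (q : Fin (r + m))
    (l : RowIdx r s m) :
    plucker (1 : Fin s → R) (fun l => Pi.single l 1) (Function.update (rowSel i) q l) =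
      (Pi.single (rowSel i q) 1 : RowIdx r s m → R) l := by
  have := contraction_secantVector_basis hgen (Pi.basisFun R (RowIdx r s m))
    (LinearMap.proj l) i q
  rw [contraction_apply, formPairing_secantVector, Pi.basisFun_apply, LinearMap.proj_apply] at this
  rw [← this]
  refine Finset.sum_congr rfl fun i' _ => ?_
  congr 2
  ext q₁ q₂
  rcases eq_or_ne q₂ q with rfl | hq
  · simp
  · simp [hq]

theorem exists_det_genericPlucker_update_ne_zero (K : Type*) [CommRing K] [Nontrivial K]
    (hs : 1 ≤ s) (hgen : s = 1 ∨ 2 ≤ m) :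
    ∃ (t : RowIdx r s m → Fin (r + m) → RowIdx r s m) (q : RowIdx r s m → Fin (r + m)),
      (Matrix.of fun l l' => genericPlucker s K (Function.update (t l) (q l) l')).det ≠ 0 := by
  choose i q hiq using exists_rowSel_eq (r := r) (m := m) hs
  let z : Fin s ⊕ RowIdx r s m × RowIdx r s m → K :=
    Sum.elim 1 fun p => (Pi.single p.1 1 : RowIdx r s m → K) p.2
  refine ⟨fun l => rowSel (i l), q, fun h0 => one_ne_zero (α := K) ?_⟩
  calc
    (1 : K) = ((MvPolynomial.eval z).mapMatrix (Matrix.of fun l l' =>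
        genericPlucker s K (Function.update (rowSel (i l)) (q l) l'))).det := by
      rw [← Matrix.det_one (n := RowIdx r s m)]
      congr 1
      ext l l'
      have := plucker_one_single_update_rowSel (R := K) hgen (i l) (q l) l'
      rw [RingHom.mapMatrix_apply, Matrix.map_apply, Matrix.of_apply, eval_genericPlucker]
      refine Eq.trans ?_ this.symm
      rw [hiq, Matrix.one_eq_pi_single]
    _ = 0 := by rw [← RingHom.map_det, h0, map_zero]

end Plucker

section Graph

variable {K R N E : Type*} [CommRing R] [Fintype N]

variable (N E) in
/-- The coefficients `λ_i` as constants in the coordinate ring of `Hom(R^N, R^E)`. -/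
def graphLam (lam : Fin s → R) (i : Fin s) : MvPolynomial (N × E) R :=
  MvPolynomial.C (lam i)

variable (E) in
/-- The coordinates of the vectors `G l` of `R^N`, moved to the graph of the generic linear map
`R^N → R^E`, in `R^N ⊕ R^E`. -/
def graphRow (G : RowIdx r s m → N → R) (l : RowIdx r s m) : N ⊕ E → MvPolynomial (N × E) R :=
  Sum.elim (fun j => MvPolynomial.C (G l j))
    fun q => ∑ j, MvPolynomial.X (j, q) * MvPolynomial.C (G l j)

theorem plucker_graph_inl (lam : Fin s → R) (G : RowIdx r s m → N → R) (t : Fin (r + m) → N) :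
    plucker (graphLam N E lam) (graphRow E G) (fun q => Sum.inl (t q)) =
      MvPolynomial.C (plucker lam G t) :=
  (map_plucker MvPolynomial.C lam G t).symm

theorem plucker_graph_update_inr (lam : Fin s → R)
    (G : RowIdx r s m → N → R) (t : Fin (r + m) → N) (q : Fin (r + m)) (c : E) :
    plucker (graphLam N E lam) (graphRow E G) (Function.update (Sum.inl ∘ t) q (Sum.inr c)) =
      ∑ j, MvPolynomial.X (j, c) * MvPolynomial.C (plucker lam G (Function.update t q j)) := by
  rw [plucker_update_eq_sum _ _ _ _ (x := fun j => MvPolynomial.X (j, c)) (c := Sum.inl)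
    fun l => by simp [graphRow]]
  refine Finset.sum_congr rfl fun j _ => ?_
  rw [← plucker_graph_inl, ← Function.comp_update]
  rfl

section Algebra

variable [Field K] [Algebra K R]

theorem pluckerAlgebra_graph_le (lam : Fin s → R) (G : RowIdx r s m → N → R) :
    pluckerAlgebra K (graphLam N E lam) (graphRow E G) ≤
      (MvPolynomial.mapAlgHom (σ := N × E) (pluckerAlgebra K lam G).val).range := by
  classical
  refine Algebra.adjoin_le (Set.range_subset_iff.2 fun t => ?_)
  rw [SetLike.mem_coe, plucker_eq_sum (G₀ := fun l j => MvPolynomial.C (G l j))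
    (y := fun j => Sum.elim (fun j' => if j = j' then 1 else 0) fun c => MvPolynomial.X (j, c))
    (h := fun l j => by rcases j with j | c <;> simp [graphRow])]
  refine sum_mem fun f _ => mul_mem (prod_mem fun q _ => ?_) ?_
  · rcases t q with j | c
    · dsimp only [Sum.elim_inl]
      split_ifs
      exacts [one_mem _, zero_mem _]
    · exact ⟨MvPolynomial.X (f q, c), MvPolynomial.map_X _ _⟩
  · exact ⟨MvPolynomial.C ⟨_, plucker_mem_pluckerAlgebra lam G f⟩,
      (MvPolynomial.map_C _ _).trans (map_plucker MvPolynomial.C lam G f)⟩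

theorem C_mem_pluckerAlgebra_graph {lam : Fin s → R} {G : RowIdx r s m → N → R} {a : R}
    (ha : a ∈ pluckerAlgebra K lam G) :
    MvPolynomial.C a ∈ pluckerAlgebra K (graphLam N E lam) (graphRow E G) := by
  suffices pluckerAlgebra K lam G ≤ (pluckerAlgebra K (graphLam N E lam) (graphRow E G)).comap
    (IsScalarTower.toAlgHom K R (MvPolynomial (N × E) R)) from this ha
  refine Algebra.adjoin_le (Set.range_subset_iff.2 fun t => ?_)
  have := plucker_mem_pluckerAlgebra (K := K) (graphLam N E lam) (graphRow E G)
    fun q => Sum.inl (t q)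
  rwa [plucker_graph_inl] at this

theorem isAlgebraic_X_graph [IsDomain R] [DecidableEq N] {lam : Fin s → R}
    {G : RowIdx r s m → N → R} {t : N → Fin (r + m) → N} {q : N → Fin (r + m)}
    (hdet : (Matrix.of fun l l' => plucker lam G (Function.update (t l) (q l) l')).det ≠ 0)
    (p : N × E) :
    IsAlgebraic (pluckerAlgebra K (graphLam N E lam) (graphRow E G))
      (MvPolynomial.X p : MvPolynomial (N × E) R) := by
  classical
  obtain ⟨j, c⟩ := p
  let A := pluckerAlgebra K (graphLam N E lam) (graphRow E G)
  let U : Matrix N N A := Matrix.of fun l l' =>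
    ⟨_, C_mem_pluckerAlgebra_graph (plucker_mem_pluckerAlgebra lam G
      (Function.update (t l) (q l) l'))⟩
  refine isAlgebraic_of_mulVec_mem (U := U) (x := fun j => MvPolynomial.X (j, c)) ?_
    (fun l => ?_) j
  · refine fun h0 => hdet (MvPolynomial.C_injective (N × E) R ?_)
    rw [RingHom.map_det, map_zero]
    exact (RingHom.map_det A.val.toRingHom U).symm.trans (by rw [h0, map_zero])
  · have := plucker_mem_pluckerAlgebra (K := K) (graphLam N E lam) (graphRow E G)
      (Function.update (Sum.inl ∘ t l) (q l) (Sum.inr c))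
    rw [plucker_graph_update_inr] at this
    convert this using 1
    exact Finset.sum_congr rfl fun j _ => mul_comm _ _

theorem trdeg_pluckerAlgebra_graph.{u} {R N E : Type u} [CommRing R] [IsDomain R] [Algebra K R]
    [Fintype N] [DecidableEq N] {lam : Fin s → R}
    {G : RowIdx r s m → N → R} {t : N → Fin (r + m) → N} {q : N → Fin (r + m)}
    (hdet : (Matrix.of fun l l' => plucker lam G (Function.update (t l) (q l) l')).det ≠ 0) :
    Algebra.trdeg K (pluckerAlgebra K (graphLam N E lam) (graphRow E G)) =
      Algebra.trdeg K (pluckerAlgebra K lam G) + Cardinal.mk (N × E) := by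
  let A₀ := pluckerAlgebra K lam G
  let ι := MvPolynomial.mapAlgHom (σ := N × E) A₀.val
  have hι : Function.Injective ι := MvPolynomial.map_injective _ Subtype.val_injective
  rw [trdeg_eq_of_le_of_isAlgebraic (pluckerAlgebra_graph_le lam G),
    ← (AlgEquiv.ofInjective ι hι).trdeg_eq, ← trdeg_add_eq K A₀ (A := MvPolynomial (N × E) A₀),
    MvPolynomial.trdeg_of_isDomain, Cardinal.lift_id]
  rintro _ ⟨F, rfl⟩
  rw [← Subalgebra.mem_algebraicClosure, AlgHom.toRingHom_eq_coe, RingHom.coe_coe]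
  induction F using MvPolynomial.induction_on with
  | C a =>
    rw [show MvPolynomial.mapAlgHom A₀.val (MvPolynomial.C a) = MvPolynomial.C a.1 from
      MvPolynomial.map_C _ _]
    exact isAlgebraic_algebraMap (⟨_, C_mem_pluckerAlgebra_graph a.2⟩ :
      pluckerAlgebra K (graphLam N E lam) (graphRow E G))
  | add F F' hF hF' => exact map_add (MvPolynomial.mapAlgHom A₀.val) F F' ▸ add_mem hF hF'
  | mul_X F p hF =>
    rw [map_mul, show MvPolynomial.mapAlgHom A₀.val (MvPolynomial.X p) = MvPolynomial.X p from
      MvPolynomial.map_X _ _]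
    exact mul_mem hF (isAlgebraic_X_graph hdet p)

end Algebra

theorem isDominant_graph {K E : Type*} [Field K] : IsDominant K
    (graphLam _ E fun i : Fin s => (MvPolynomial.X (Sum.inl i) :
      MvPolynomial (Fin s ⊕ RowIdx r s m × RowIdx r s m) K))
    (graphRow E fun l j => MvPolynomial.X (Sum.inr (l, j))) := by
  refine ⟨(Matrix.of fun l l' => MvPolynomial.X (Sum.inr (l, Sum.inl l'))).det,
    fun h0 => ?_, fun z hz => ?_⟩
  · let z : Fin s ⊕ RowIdx r s m × (RowIdx r s m ⊕ E) → K := Sum.elim 0 fun p =>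
      Sum.elim ((1 : Matrix (RowIdx r s m) (RowIdx r s m) K) p.1) 0 p.2
    refine one_ne_zero (α := K) ?_
    rw [← Matrix.det_one (n := RowIdx r s m), ← map_zero (MvPolynomial.eval z), ← h0,
      RingHom.map_det]
    congr 1
    ext l l'
    simp [z]
  · let A₀ : Matrix (RowIdx r s m) (RowIdx r s m) K :=
      Matrix.of fun l j => z (Sum.inr (l, Sum.inl j))
    let A₁ : Matrix (RowIdx r s m) E K := Matrix.of fun l c => z (Sum.inr (l, Sum.inr c))
    have hA₀ : IsUnit A₀.det := isUnit_iff_ne_zero.2 <| by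
      rw [RingHom.map_det] at hz
      convert hz
      ext l l'
      simp [A₀]
    have hsolve (l : RowIdx r s m) (c : E) : ∑ j, (A₀⁻¹ * A₁) j c * A₀ l j = A₁ l c := by
      have := congrFun (congrFun (Matrix.mul_nonsing_inv_cancel_left A₀ A₁ hA₀) l) c
      simpa only [Matrix.mul_apply (M := A₀), mul_comm] using this
    refine ⟨MvPolynomial.aevalTower
      (MvPolynomial.aeval (Sum.elim (fun i => z (Sum.inl i)) fun p => A₀ p.1 p.2))
      fun p => (A₀⁻¹ * A₁) p.1 p.2, fun t => ?_⟩
    rw [eval_genericPlucker, ← AlgHom.coe_toRingHom, map_plucker]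
    congr 1
    · ext i
      simp [graphLam]
    · ext l j
      rcases j with j | c
      · simp [graphRow, A₀]
      · simp only [graphRow, Sum.elim_inr, RingHom.coe_coe, map_sum, map_mul,
          MvPolynomial.aevalTower_X, MvPolynomial.aevalTower_C, MvPolynomial.aeval_X]
        exact (hsolve l c).symm

end Graph

theorem ringKrullDim_restrictedSecantPoints_add (hs : 1 ≤ s) (hgen : s = 1 ∨ 2 ≤ m) (e : ℕ) :
    ringKrullDim (CoordinateRing (pluckerBasis (r + m) (r + s * m + e))
      (restrictedSecantPoints (r + m) r s (r + s * m + e))) =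
        ((Algebra.trdeg ℂ (genericPluckerAlgebra r s m ℂ (RowIdx r s m))).toNat +
          (r + s * m) * e : ℕ) := by
  obtain ⟨t, q, hdet⟩ := exists_det_genericPlucker_update_ne_zero (r := r) ℂ hs hgen
  let eq : Fin (r + s * m + e) ≃ RowIdx r s m ⊕ Fin e := finSumFinEquiv.symm.trans
    (Equiv.sumCongr (Fintype.equivFinOfCardEq (by simp)).symm (Equiv.refl _))
  have hle : m ≤ s * m := Nat.le_mul_of_pos_left m hs
  rw [isDominant_graph.ringKrullDim_restrictedSecantPoints eq hs (by omega),
    trdeg_pluckerAlgebra_graph hdet, Cardinal.toNat_add (trdeg_pluckerAlgebra_lt_aleph0 _ _)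
    Cardinal.mk_lt_aleph0, Cardinal.mk_fintype, Cardinal.toNat_natCast]
  simp

/-! ### An affine chart -/

theorem inl_mem_range_rowSel (i : Fin s) (a : Fin r) :
    (Sum.inl a : RowIdx r s m) ∈ Set.range (rowSel i) :=
  ⟨_, rowSel_castAdd i a⟩

theorem inr_mem_range_rowSel {i : Fin s} {p : Fin s × Fin m} :
    (Sum.inr p : RowIdx r s m) ∈ Set.range (rowSel i) ↔ p.1 = i := by
  constructor
  · rintro ⟨q, hq⟩
    refine Fin.addCases (fun a ha => ?_) (fun c hc => ?_) q hq
    · simp at ha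
    · rw [rowSel_natAdd, Sum.inr.injEq] at hc
      rw [← hc]
  · rintro rfl
    exact ⟨_, rowSel_natAdd p.1 p.2⟩

theorem range_rowSel_injective (hm : 1 ≤ m ∨ s = 1) :
    Function.Injective fun i : Fin s => Set.range (rowSel (r := r) (m := m) i) := by
  rcases hm with hm | rfl
  · intro i i' h
    have hmem : (Sum.inr (i, ⟨0, hm⟩) : RowIdx r s m) ∈ Set.range (rowSel i) :=
      inr_mem_range_rowSel.2 rfl
    exact inr_mem_range_rowSel.1 ((Set.ext_iff.1 h _).1 hmem)
  · exact Function.injective_of_subsingleton _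

theorem eq_of_forall_mem_range_rowSel (hm : 3 ≤ m ∨ s = 1) {i i' : Fin s} {l j : RowIdx r s m}
    (h : ∀ x ∈ Set.range (rowSel i), x ≠ l → x = j ∨ x ∈ Set.range (rowSel i')) : i = i' := by
  rcases hm with hm | rfl
  · have hinj : Function.Injective fun c : Fin m => (Sum.inr (i, c) : RowIdx r s m) :=
      Sum.inr_injective.comp (Prod.mk_right_injective i)
    have hcard : ({l, j} : Finset (RowIdx r s m)).card <
        (Finset.univ.map ⟨_, hinj⟩).card := by
      rw [Finset.card_map, Finset.card_univ, Fintype.card_fin]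
      exact Finset.card_le_two.trans_lt hm
    obtain ⟨x, hx, hxlj⟩ := Finset.exists_mem_notMem_of_card_lt_card hcard
    obtain ⟨c, -, rfl⟩ := Finset.mem_map.1 hx
    rw [Finset.mem_insert, Finset.mem_singleton, not_or] at hxlj
    exact inr_mem_range_rowSel.1
      ((h _ (inr_mem_range_rowSel.2 rfl) hxlj.1).resolve_left hxlj.2)
  · exact Subsingleton.elim i i'

theorem mem_range_update_id_comp {α β : Type*} [DecidableEq β] {f : α → β} {l : β}
    (hl : l ∈ Set.range f) {j x : β} :
    x ∈ Set.range (Function.update id l j ∘ f) ↔ x = j ∨ x ∈ Set.range f ∧ x ≠ l := by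
  obtain ⟨q, rfl⟩ := hl
  constructor
  · rintro ⟨q', rfl⟩
    rcases eq_or_ne (f q') (f q) with h | h
    · simp [h]
    · simp [h]
  · rintro (rfl | ⟨⟨q', rfl⟩, h⟩)
    · exact ⟨q, by simp⟩
    · exact ⟨q', by simp [h]⟩

theorem injective_update_id_comp {α β : Type*} [DecidableEq β] {f : α → β}
    (hf : Function.Injective f) {l j : β} (hj : j ∉ Set.range f) :
    Function.Injective (Function.update id l j ∘ f) := by
  intro q q' h
  simp only [Function.comp_apply, Function.update_apply, id_eq] at h
  split_ifs at h with hq hq' hq'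
  · exact hf (hq.trans hq'.symm)
  · exact absurd ⟨q', h.symm⟩ hj
  · exact absurd ⟨q, h⟩ hj
  · exact hf h

section Exchange

variable {i i' : Fin s} {l j l' j' : RowIdx r s m}

theorem range_update_id_comp_rowSel_ne (hm : 3 ≤ m ∨ s = 1) (hl : l ∈ Set.range (rowSel i))
    (hlj : l ≠ j) :
    Set.range (Function.update id l j ∘ rowSel i) ≠ Set.range (rowSel i') := by
  intro h
  obtain rfl : i = i' := eq_of_forall_mem_range_rowSel hm (l := l) (j := j) fun x hx hxl =>
    .inr (h ▸ (mem_range_update_id_comp hl).2 (.inr ⟨hx, hxl⟩))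
  rw [← h, mem_range_update_id_comp (h ▸ hl)] at hl
  tauto

theorem eq_of_range_update_id_comp_rowSel_eq (hm : 3 ≤ m ∨ s = 1)
    (hl : l ∈ Set.range (rowSel i)) (hl' : l' ∈ Set.range (rowSel i'))
    (hj' : j' ∉ Set.range (rowSel i'))
    (h : Set.range (Function.update id l j ∘ rowSel i) =
      Set.range (Function.update id l' j' ∘ rowSel i')) : i = i' ∧ l = l' ∧ j = j' := by
  simp only [Set.ext_iff, mem_range_update_id_comp hl, mem_range_update_id_comp hl'] at h
  obtain rfl : i = i' := eq_of_forall_mem_range_rowSel hm fun x hx hxl =>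
    ((h x).1 (.inr ⟨hx, hxl⟩)).imp_right And.left
  have hlj' : l' ≠ j' := fun h => hj' (h ▸ hl')
  have hl'l := h l'
  have hj'j := h j'
  refine ⟨rfl, ?_, ?_⟩ <;> tauto

end Exchange

section Jacobian

variable {R T : Type*} [CommRing R] [DecidableEq T] {k : ℕ}

theorem det_one_submatrix_eq_zero {ρ t : Fin k → T} (h : Set.range ρ ≠ Set.range t) :
    ((1 : Matrix T T R).submatrix ρ t).det = 0 := by
  contrapose! h
  refine subset_antisymm (Set.range_subset_iff.2 fun q => ?_) (Set.range_subset_iff.2 fun q => ?_)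
  · by_contra hq
    exact h (Matrix.det_eq_zero_of_row_eq_zero q fun q' =>
      Matrix.one_apply_ne fun h => hq ⟨q', h.symm⟩)
  · by_contra hq
    exact h (Matrix.det_eq_zero_of_column_eq_zero q fun q' =>
      Matrix.one_apply_ne fun h => hq ⟨q', h⟩)

theorem det_one_submatrix_self {ρ : Fin k → T} (hρ : Function.Injective ρ) :
    ((1 : Matrix T T R).submatrix ρ ρ).det = 1 := by
  rw [Matrix.submatrix_one ρ hρ, Matrix.det_one]

open Classical in
theorem det_one_add_single_submatrix {ρ : Fin k → T} (hρ : Function.Injective ρ) (t : Fin k → T)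
    (l j : T) (τ : R) : ((1 + Matrix.single l j τ).submatrix ρ t).det =
      ((1 : Matrix T T R).submatrix ρ t).det + (if l ∈ Set.range ρ then
        ((1 : Matrix T T R).submatrix (Function.update id l j ∘ ρ) t).det else 0) * τ := by
  set M := (1 : Matrix T T R).submatrix ρ t with hM
  split_ifs with hl
  · obtain ⟨q, rfl⟩ := hl
    have hrow : (1 + Matrix.single (ρ q) j τ).submatrix ρ t =
        M.updateRow q (M q + τ • fun q' => (1 : Matrix T T R) j (t q')) := by
      ext q₁ q₂
      rcases eq_or_ne q₁ q with rfl | hq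
      · simp [M, Matrix.single, Matrix.one_apply]
      · simp [M, hq, hρ.eq_iff, hq.symm]
    rw [hrow, Matrix.det_updateRow_add, Matrix.updateRow_eq_self, Matrix.det_updateRow_smul,
      mul_comm τ]
    congr 3
    ext q₁ q₂
    rw [Matrix.submatrix_apply, Function.comp_apply]
    rcases eq_or_ne q₁ q with rfl | hq
    · rw [Matrix.updateRow_self, Function.update_self]
    · rw [Matrix.updateRow_ne hq, Function.update_of_ne (hρ.ne hq)]
      rfl
  · rw [zero_mul, add_zero, hM]
    congr 1
    ext q q'
    simp [Matrix.single_apply_of_row_ne fun h => hl ⟨q, h.symm⟩]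

variable (r s m R) in
/-- The parameters `λ_i = 1` and `G l = e_l` of the generic secant vector. -/
def basePoint : Fin s ⊕ RowIdx r s m × RowIdx r s m → R :=
  Sum.elim 1 fun p => (1 : Matrix (RowIdx r s m) (RowIdx r s m) R) p.1 p.2

variable [IsDomain R] [Infinite R]

theorem eval_basePoint_pderiv_inl (i : Fin s) (t : Fin (r + m) → RowIdx r s m) :
    MvPolynomial.eval (basePoint r s m R) (MvPolynomial.pderiv (Sum.inl i) (genericPlucker s R t)) =
      ((1 : Matrix _ _ R).submatrix (rowSel i) t).det := by
  classical
  refine eval_pderiv_of_eval_line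
    (a := ∑ i : Fin s, ((1 : Matrix (RowIdx r s m) (RowIdx r s m) R).submatrix (rowSel i) t).det)
    fun τ => ?_
  set z := basePoint r s m R + Pi.single (Sum.inl i) τ with hz
  have hlam (i' : Fin s) : z (Sum.inl i') = 1 + if i' = i then τ else 0 := by
    simp [hz, basePoint, Pi.single_apply]
  have hrow (l j : RowIdx r s m) : z (Sum.inr (l, j)) = (1 : Matrix _ _ R) l j := by
    simp [hz, basePoint]
  simp only [eval_genericPlucker, plucker, hlam, hrow, add_mul, one_mul, ite_mul, zero_mul,
    Finset.sum_add_distrib, Finset.sum_ite_eq', Finset.mem_univ, if_true]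
  rw [mul_comm τ]
  rfl

open Classical in
theorem eval_basePoint_pderiv_inr (l j : RowIdx r s m) (t : Fin (r + m) → RowIdx r s m) :
    MvPolynomial.eval (basePoint r s m R)
        (MvPolynomial.pderiv (Sum.inr (l, j)) (genericPlucker s R t)) =
      ∑ i : Fin s, if l ∈ Set.range (rowSel i) then
        ((1 : Matrix _ _ R).submatrix (Function.update id l j ∘ rowSel i) t).det else 0 := by
  refine eval_pderiv_of_eval_line
    (a := ∑ i : Fin s, ((1 : Matrix (RowIdx r s m) (RowIdx r s m) R).submatrix (rowSel i) t).det)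
    fun τ => ?_
  set z := basePoint r s m R + Pi.single (Sum.inr (l, j)) τ with hz
  have hlam (i : Fin s) : z (Sum.inl i) = 1 := by simp [hz, basePoint]
  have hrow (l' j' : RowIdx r s m) :
      z (Sum.inr (l', j')) = (1 + Matrix.single l j τ : Matrix _ _ R) l' j' := by
    simp [hz, basePoint, Matrix.single, Pi.single_apply, eq_comm]
  simp only [eval_genericPlucker, plucker, hlam, hrow, one_mul]
  rw [Finset.sum_mul, ← Finset.sum_add_distrib]
  exact Finset.sum_congr rfl fun i _ => det_one_add_single_submatrix (rowSel_injective i) t l j τ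

/-- At the point `E_i = span {e_q | q ∈ Set.range (rowSel i)}`, some plane `E_i` contains `e_l` but
not `e_j`. The entries `(l, j)` of this kind are the coordinates of an affine chart. -/
def IsFree (l j : RowIdx r s m) : Prop :=
  ∃ i : Fin s, l ∈ Set.range (rowSel i) ∧ j ∉ Set.range (rowSel i)

variable (r s m) in
/-- The index set of the free entries. -/
abbrev FreeEntry : Type := {p : RowIdx r s m × RowIdx r s m // IsFree p.1 p.2}

instance : DecidableEq (FreeEntry r s m) := Subtype.instDecidableEq

open Classical in
/-- The Plücker coordinate which is, to first order at `basePoint`, a given parameter of the chart: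
that of `E_i` for `λ_i`, and that of some `E_i` with `e_l` replaced by `e_j` for the entry
`(l, j)`. -/
def chartTuple : Fin s ⊕ FreeEntry r s m → Fin (r + m) → RowIdx r s m :=
  Sum.elim rowSel fun p => Function.update id p.1.1 p.1.2 ∘ rowSel p.2.choose

theorem eval_basePoint_pderiv_inl_chartTuple (hm : 3 ≤ m ∨ s = 1) (i : Fin s)
    (d : Fin s ⊕ FreeEntry r s m) :
    MvPolynomial.eval (basePoint r s m R)
      (MvPolynomial.pderiv (Sum.inl i) (genericPlucker s R (chartTuple d))) =
        (1 : Matrix (Fin s ⊕ FreeEntry r s m) _ R) (Sum.inl i) d := by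
  rw [eval_basePoint_pderiv_inl]
  rcases d with i' | ⟨p, hp⟩
  · rcases eq_or_ne i i' with rfl | hi
    · rw [Matrix.one_apply_eq]
      exact det_one_submatrix_self (rowSel_injective i)
    · rw [Matrix.one_apply_ne (Sum.inl_injective.ne hi)]
      exact det_one_submatrix_eq_zero
        ((range_rowSel_injective (hm.imp_left (by omega : 3 ≤ m → 1 ≤ m))).ne hi)
  · rw [Matrix.one_apply_ne Sum.inl_ne_inr]
    obtain ⟨hl, hj⟩ := hp.choose_spec
    exact det_one_submatrix_eq_zero
      (range_update_id_comp_rowSel_ne hm hl (ne_of_mem_of_not_mem hl hj)).symm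

theorem eval_basePoint_pderiv_inr_chartTuple (hm : 3 ≤ m ∨ s = 1) (p : FreeEntry r s m)
    (d : Fin s ⊕ FreeEntry r s m) :
    MvPolynomial.eval (basePoint r s m R)
      (MvPolynomial.pderiv (Sum.inr p.1) (genericPlucker s R (chartTuple d))) =
        (1 : Matrix (Fin s ⊕ FreeEntry r s m) _ R) (Sum.inr p) d := by
  classical
  rw [eval_basePoint_pderiv_inr]
  obtain ⟨hl, hj⟩ := p.2.choose_spec
  rcases d with i' | p'
  · rw [Matrix.one_apply_ne Sum.inr_ne_inl]
    refine Finset.sum_eq_zero fun i _ => ite_eq_right_iff.2 fun hli => ?_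
    exact det_one_submatrix_eq_zero
      (range_update_id_comp_rowSel_ne hm hli (ne_of_mem_of_not_mem hl hj))
  · obtain ⟨hl', hj'⟩ := p'.2.choose_spec
    rcases eq_or_ne p p' with rfl | hp
    · rw [Matrix.one_apply_eq, Finset.sum_eq_single p.2.choose, if_pos hl]
      · exact det_one_submatrix_self (injective_update_id_comp (rowSel_injective _) hj)
      · refine fun i _ hi => ite_eq_right_iff.2 fun hli => det_one_submatrix_eq_zero fun h => ?_
        exact hi (eq_of_range_update_id_comp_rowSel_eq hm hli hl hj h).1
      · exact fun h => absurd (Finset.mem_univ _) h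
    · rw [Matrix.one_apply_ne (Sum.inr_injective.ne hp)]
      refine Finset.sum_eq_zero fun i _ => ite_eq_right_iff.2 fun hli =>
        det_one_submatrix_eq_zero fun h => hp (Subtype.ext (Prod.ext_iff.2 ?_))
      exact (eq_of_range_update_id_comp_rowSel_eq hm hli hl' hj' h).2

theorem algebraicIndependent_genericPlucker_chartTuple [CharZero R] (hm : 3 ≤ m ∨ s = 1) :
    AlgebraicIndependent R fun d : Fin s ⊕ FreeEntry r s m =>
      genericPlucker s R (chartTuple d) := by
  classical
  have := Fintype.ofFinite (FreeEntry r s m)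
  refine algebraicIndependent_of_det_jacobian_ne_zero _ (Sum.map id Subtype.val)
    (basePoint r s m R) ?_
  have hJ : (Matrix.of fun d d' : Fin s ⊕ FreeEntry r s m => MvPolynomial.eval (basePoint r s m R)
      (MvPolynomial.pderiv (Sum.map id Subtype.val d) (genericPlucker s R (chartTuple d')))) =
        1 := by
    ext (i | p) d
    · exact eval_basePoint_pderiv_inl_chartTuple hm i d
    · exact eval_basePoint_pderiv_inr_chartTuple hm p d
  rw [hJ, Matrix.det_one]
  exact one_ne_zero

theorem natCard_le_trdeg_genericPluckerAlgebra (K : Type*) [Field K] [CharZero K]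
    (hm : 3 ≤ m ∨ s = 1) : Nat.card (Fin s ⊕ FreeEntry r s m) ≤
      (Algebra.trdeg K (genericPluckerAlgebra r s m K (RowIdx r s m))).toNat := by
  let x (d : Fin s ⊕ FreeEntry r s m) : genericPluckerAlgebra r s m K (RowIdx r s m) :=
    ⟨genericPlucker s K (chartTuple d), plucker_mem_pluckerAlgebra _ _ _⟩
  have hx : AlgebraicIndependent K x :=
    .of_comp (Subalgebra.val _) (algebraicIndependent_genericPlucker_chartTuple hm)
  have := hx.lift_cardinalMk_le_trdeg
  rw [Nat.card, ← Cardinal.toNat_lift.{_, 0}]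
  exact Cardinal.toNat_le_toNat (by simpa using this) (trdeg_pluckerAlgebra_lt_aleph0 _ _)

end Jacobian

section Chart

variable {R R' : Type*} [CommRing R] [CommRing R']

theorem not_isFree_inl (l : RowIdx r s m) (a : Fin r) : ¬IsFree l (Sum.inl a) :=
  fun ⟨i, _, h⟩ => h (inl_mem_range_rowSel i a)

theorem isFree_inl_inr (hsm : 2 ≤ s ∨ m = 0) (a : Fin r) (b : Fin s × Fin m) :
    IsFree (Sum.inl a) (Sum.inr b) := by
  rcases hsm with hs | rfl
  · have := Fin.nontrivial_iff_two_le.2 hs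
    obtain ⟨i, hi⟩ := exists_ne b.1
    exact ⟨i, inl_mem_range_rowSel i a, fun h => hi (inr_mem_range_rowSel.1 h).symm⟩
  · exact b.2.elim0

theorem isFree_inr_inr {b b' : Fin s × Fin m} :
    IsFree (Sum.inr b : RowIdx r s m) (Sum.inr b') ↔ b.1 ≠ b'.1 := by
  simp only [IsFree, inr_mem_range_rowSel, exists_eq_left', ne_comm]

theorem IsFree.lt {i : Fin s} {q q' : Fin (r + m)} (h : IsFree (rowSel i q) (rowSel i q')) :
    q < q' := by
  induction q' using Fin.addCases with
  | left a' =>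
    rw [rowSel_castAdd] at h
    exact absurd h (not_isFree_inl _ a')
  | right c' =>
    induction q using Fin.addCases with
    | left a =>
      rw [Fin.lt_def, Fin.val_castAdd, Fin.val_natAdd]
      omega
    | right c =>
      rw [rowSel_natAdd, rowSel_natAdd, isFree_inr_inr] at h
      exact absurd rfl h

open Classical in
/-- The vectors in the affine chart around `basePoint` with free entries `z`. -/
def chartRow (z : FreeEntry r s m → R) (l j : RowIdx r s m) : R :=
  if h : IsFree l j then z ⟨(l, j), h⟩ else (1 : Matrix (RowIdx r s m) (RowIdx r s m) R) l j

theorem map_chartRow (φ : R →+* R') (z : FreeEntry r s m → R) (l j : RowIdx r s m) :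
    φ (chartRow z l j) = chartRow (φ ∘ z) l j := by
  unfold chartRow
  split_ifs
  · rfl
  · rw [Matrix.one_apply, Matrix.one_apply, apply_ite φ, map_one, map_zero]

theorem chartRow_eq_self {G : RowIdx r s m → RowIdx r s m → R}
    (h : ∀ l j, ¬IsFree l j → G l j = (1 : Matrix _ _ R) l j) :
    chartRow (fun p => G p.1.1 p.1.2) = G := by
  ext l j
  unfold chartRow
  split_ifs with hlj
  · rfl
  · exact (h l j hlj).symm

/-- The coordinates of the vectors spanning `E_i` with respect to the basis vectors indexed by the
same `r + m` indices. -/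
def planeBlock (G : RowIdx r s m → RowIdx r s m → R) (i : Fin s) :
    Matrix (Fin (r + m)) (Fin (r + m)) R :=
  Matrix.of fun q q' => G (rowSel i q) (rowSel i q')

/-- The coordinates of the first `r` vectors with respect to the first `r` basis vectors. -/
def commonBlock (G : RowIdx r s m → RowIdx r s m → R) : Matrix (Fin r) (Fin r) R :=
  Matrix.of fun a a' => G (Sum.inl a) (Sum.inl a')

theorem det_planeBlock_chartRow (z : FreeEntry r s m → R) (i : Fin s) :
    (planeBlock (chartRow z) i).det = 1 := by
  have hle {q q' : Fin (r + m)} (h : q' ≤ q) :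
      planeBlock (chartRow z) i q q' = (1 : Matrix _ _ R) (rowSel i q) (rowSel i q') :=
    dif_neg fun hfree => h.not_gt hfree.lt
  have hupper : (planeBlock (chartRow z) i).IsUpperTriangular := fun q q' hq =>
    (hle (le_of_lt hq)).trans (Matrix.one_apply_ne ((rowSel_injective i).ne (ne_of_gt hq)))
  rw [Matrix.det_of_isUpperTriangular hupper]
  exact Finset.prod_eq_one fun q _ => (hle le_rfl).trans (Matrix.one_apply_eq _)

theorem plucker_eq_of_row_operations (lam : Fin s → R) {J : Type*} {G G' : RowIdx r s m → J → R}
    (L : Fin s → Matrix (Fin (r + m)) (Fin (r + m)) R)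
    (h : ∀ i q j, G' (rowSel i q) j = ∑ q', L i q q' * G (rowSel i q') j)
    (t : Fin (r + m) → J) : plucker lam G' t = plucker (fun i => lam i * (L i).det) G t := by
  refine Finset.sum_congr rfl fun i _ => ?_
  rw [mul_assoc, ← Matrix.det_mul]
  congr 2
  ext q q'
  exact h i q (t q')

end Chart

section RowReduction

variable {K : Type*} [Field K] {G : RowIdx r s m → RowIdx r s m → K}

/-- The result of the row reduction which turns `commonBlock G` into the identity matrix and the
last `m` rows of each `planeBlock G i` into those of the identity matrix. -/
def reducedRow (G : RowIdx r s m → RowIdx r s m → K) : RowIdx r s m → RowIdx r s m → K :=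
  Sum.elim (fun a j => ∑ a', (commonBlock G)⁻¹ a a' * G (Sum.inl a') j)
    fun b j => ∑ q, (planeBlock G b.1)⁻¹ (Fin.natAdd r b.2) q * G (rowSel b.1 q) j

/-- The matrix of the row operations on `E_i` which produce `reducedRow G`. -/
def rowReduction (G : RowIdx r s m → RowIdx r s m → K) (i : Fin s) :
    Matrix (Fin (r + m)) (Fin (r + m)) K :=
  Matrix.of (Fin.addCases (fun a => Fin.append ((commonBlock G)⁻¹ a) 0)
    fun c => (planeBlock G i)⁻¹ (Fin.natAdd r c))

theorem reducedRow_rowSel (i : Fin s) (q : Fin (r + m)) (j : RowIdx r s m) :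
    reducedRow G (rowSel i q) j = ∑ q', rowReduction G i q q' * G (rowSel i q') j := by
  induction q using Fin.addCases with
  | left a => simp [reducedRow, rowReduction, Fin.sum_univ_add]
  | right c => simp [reducedRow, rowReduction]

theorem reducedRow_inl_inl (hA : (commonBlock G).det ≠ 0) (a a' : Fin r) :
    reducedRow G (Sum.inl a) (Sum.inl a') = (1 : Matrix _ _ K) a a' := by
  rw [← Matrix.nonsing_inv_mul _ (isUnit_iff_ne_zero.2 hA), Matrix.mul_apply]
  rfl

theorem reducedRow_inr_rowSel {b : Fin s × Fin m} (hC : (planeBlock G b.1).det ≠ 0)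
    (q : Fin (r + m)) :
    reducedRow G (Sum.inr b) (rowSel b.1 q) = (1 : Matrix _ _ K) (Fin.natAdd r b.2) q := by
  rw [← Matrix.nonsing_inv_mul _ (isUnit_iff_ne_zero.2 hC), Matrix.mul_apply]
  rfl

theorem chartRow_reducedRow (hsm : 2 ≤ s ∨ m = 0) (hA : (commonBlock G).det ≠ 0)
    (hC : ∀ i, (planeBlock G i).det ≠ 0) :
    chartRow (fun p => reducedRow G p.1.1 p.1.2) = reducedRow G := by
  refine chartRow_eq_self fun l j h => ?_
  rcases l with a | b
  · rcases j with a' | b'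
    · rw [reducedRow_inl_inl hA, Matrix.one_apply, Matrix.one_apply]
      simp only [Sum.inl.injEq]
    · exact absurd (isFree_inl_inr hsm a b') h
  · obtain ⟨q, rfl⟩ : j ∈ Set.range (rowSel b.1) := by
      by_contra hj
      exact h ⟨b.1, inr_mem_range_rowSel.2 rfl, hj⟩
    rw [reducedRow_inr_rowSel (hC b.1), ← rowSel_natAdd, Matrix.one_apply, Matrix.one_apply]
    simp only [(rowSel_injective b.1).eq_iff]

theorem exists_plucker_eq_plucker_chartRow (hsm : 2 ≤ s ∨ m = 0) (lam : Fin s → K)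
    (hA : (commonBlock G).det ≠ 0) (hC : ∀ i, (planeBlock G i).det ≠ 0) :
    ∃ (lam' : Fin s → K) (z : FreeEntry r s m → K),
      ∀ t, plucker lam G t = plucker lam' (chartRow z) t := by
  refine ⟨fun i => lam i * (planeBlock G i).det, fun p => reducedRow G p.1.1 p.1.2, fun t => ?_⟩
  have hdet (i : Fin s) : (planeBlock G i).det * (rowReduction G i).det = 1 := calc
    (planeBlock G i).det * (rowReduction G i).det
        = (planeBlock (reducedRow G) i).det := by
      rw [mul_comm, ← Matrix.det_mul]
      congr 1
      ext q q'
      exact (reducedRow_rowSel i q _).symm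
    _ = 1 := by rw [← chartRow_reducedRow hsm hA hC, det_planeBlock_chartRow]
  rw [chartRow_reducedRow hsm hA hC,
    plucker_eq_of_row_operations _ (rowReduction G) reducedRow_rowSel]
  simp only [mul_assoc, hdet, mul_one]

theorem isDominant_chart (hsm : 2 ≤ s ∨ m = 0) : IsDominant K
    (fun i => (MvPolynomial.X (Sum.inl i) : MvPolynomial (Fin s ⊕ FreeEntry r s m) K))
    (chartRow fun p => MvPolynomial.X (Sum.inr p)) := by
  let X (l j : RowIdx r s m) : MvPolynomial (Fin s ⊕ RowIdx r s m × RowIdx r s m) K :=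
    MvPolynomial.X (Sum.inr (l, j))
  have heval (z : Fin s ⊕ RowIdx r s m × RowIdx r s m → K) :
      MvPolynomial.eval z ((commonBlock X).det * ∏ i, (planeBlock X i).det) =
        (commonBlock fun l j => z (Sum.inr (l, j))).det *
          ∏ i, (planeBlock (fun l j => z (Sum.inr (l, j))) i).det := by
    simp only [map_mul, map_prod, RingHom.map_det]
    congr! 3 <;> ext <;> simp [X, commonBlock, planeBlock]
  refine ⟨(commonBlock X).det * ∏ i, (planeBlock X i).det, fun h0 => ?_, fun z hz => ?_⟩
  · have := heval (basePoint r s m K)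
    rw [h0, map_zero] at this
    have hA : (commonBlock fun l j => basePoint r s m K (Sum.inr (l, j))).det = 1 :=
      det_one_submatrix_self Sum.inl_injective
    have hC (i : Fin s) :
        (planeBlock (fun l j => basePoint r s m K (Sum.inr (l, j))) i).det = 1 :=
      det_one_submatrix_self (rowSel_injective i)
    simp only [hA, hC, Finset.prod_const_one, mul_one] at this
    exact zero_ne_one this
  · rw [heval] at hz
    obtain ⟨lam, w, h⟩ := exists_plucker_eq_plucker_chartRow hsm (fun i => z (Sum.inl i))
      (left_ne_zero_of_mul hz) fun i =>
        Finset.prod_ne_zero_iff.1 (right_ne_zero_of_mul hz) i (Finset.mem_univ i)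
    refine ⟨MvPolynomial.aeval (Sum.elim lam w), fun t => ?_⟩
    rw [eval_genericPlucker, h, ← AlgHom.coe_toRingHom, map_plucker]
    congr 1
    · ext i
      simp
    · ext l j
      rw [map_chartRow]
      congr 1
      ext p
      simp

end RowReduction

theorem natCard_freeEntry (hsm : 2 ≤ s ∨ m = 0) :
    Nat.card (FreeEntry r s m) = r * (s * m) + s * (m * ((s - 1) * m)) := by
  classical
  have hrow (i : Fin s) : ∑ b : Fin s × Fin m, (if i ≠ b.1 then 1 else 0) = (s - 1) * m := by
    calc
      _ = ∑ i' : Fin s, if i ≠ i' then m else 0 := by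
        rw [Fintype.sum_prod_type]
        refine Finset.sum_congr rfl fun i' _ => ?_
        split_ifs <;> simp
      _ = (s - 1) * m := by
        rw [← Finset.sum_filter, Finset.filter_ne, Finset.sum_const, Finset.card_erase_of_mem
          (Finset.mem_univ i), Finset.card_univ, Fintype.card_fin, smul_eq_mul]
  rw [Nat.card_eq_fintype_card, Fintype.card_subtype, Finset.card_filter, Fintype.sum_prod_type]
  simp only [Fintype.sum_sum_type, not_isFree_inl, isFree_inl_inr hsm, isFree_inr_inr, hrow,
    if_true, if_false, Finset.sum_const, Finset.card_univ, Fintype.card_fin, Fintype.card_prod,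
    smul_eq_mul, mul_zero, mul_one, zero_add, mul_assoc]

theorem trdeg_pluckerAlgebra_le_natCard {K σ J : Type*} [Field K] [Finite σ]
    (lam : Fin s → MvPolynomial σ K) (G : RowIdx r s m → J → MvPolynomial σ K) :
    (Algebra.trdeg K (pluckerAlgebra K lam G)).toNat ≤ Nat.card σ := by
  have h := trdeg_le_of_injective (pluckerAlgebra K lam G).val Subtype.val_injective
  rw [MvPolynomial.trdeg_of_isDomain] at h
  simpa [Nat.card] using Cardinal.toNat_le_toNat h (by simp)

theorem toNat_trdeg_genericPluckerAlgebra (h : 2 ≤ s ∧ 3 ≤ m ∨ s = 1 ∧ m = 0) :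
    (Algebra.trdeg ℂ (genericPluckerAlgebra r s m ℂ (RowIdx r s m))).toNat =
      r * (s * m) + s * (m * ((s - 1) * m)) + s := by
  have hs : 1 ≤ s := by omega
  have hsm : 2 ≤ s ∨ m = 0 := by omega
  rw [← natCard_freeEntry hsm, add_comm, ← Nat.card_fin s, ← Nat.card_sum, Nat.card_fin]
  refine le_antisymm ?_ (natCard_le_trdeg_genericPluckerAlgebra ℂ (by omega))
  let e : Fin (r + s * m) ≃ RowIdx r s m := (Fintype.equivFinOfCardEq (by simp)).symm
  have hle : r + m ≤ r + s * m := Nat.add_le_add_left (Nat.le_mul_of_pos_left m hs) r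
  have hdim := IsDominant.generic.ringKrullDim_restrictedSecantPoints e hs hle
  rw [(isDominant_chart hsm).ringKrullDim_restrictedSecantPoints e hs hle] at hdim
  exact (Nat.cast_injective (R := WithBot ℕ∞) hdim).symm.trans_le
    (trdeg_pluckerAlgebra_le_natCard _ _)

/-! ### Orbit stability and dimensions -/

section Degenerate

variable {k n : ℕ}

theorem mk_smul_ιMulti_mem_grassmannian (c : ℂ) (e : Fin k → V n)
    (h : c • exteriorPower.ιMulti ℂ k e ≠ 0) : Projectivization.mk ℂ _ h ∈ grassmannian k n := by
  have hω := right_ne_zero_of_smul h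
  exact ⟨_, _, hω, ⟨e, ιMulti_ne_zero_iff.1 hω, rfl, rfl⟩,
    (Projectivization.mk_eq_mk_iff' ℂ _ _ h hω).2 ⟨c, rfl⟩⟩

theorem grassmannian_subset_restrictedSecantPoints (hr : r ≤ k) (hs : 1 ≤ s) :
    grassmannian k n ⊆ restrictedSecantPoints k r s n := by
  rintro _ ⟨E, ω, hω, hE, rfl⟩
  let i₀ : Fin s := ⟨0, hs⟩
  have : Nonempty (Fin s) := ⟨i₀⟩
  have hsum : ∑ i : Fin s, (Pi.single i₀ 1 : Fin s → ℂ) i • ω = ω := by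
    rw [← Finset.sum_smul, Finset.sum_pi_single', if_pos (Finset.mem_univ _), one_smul]
  refine ⟨fun _ => E, fun _ => ω, Pi.single i₀ 1, hsum.symm ▸ hω, fun _ => hE, ?_, ?_⟩
  · obtain ⟨e, he, rfl, -⟩ := hE
    rwa [ciInf_const, finrank_span_eq_card he, Fintype.card_fin]
  · congr 1
    exact hsum.symm

theorem exists_secantVector_eq_smul_ιMulti (hs : 1 ≤ s) (h : s = 1 ∨ m ≤ 1)
    (lam : Fin s → ℂ) (G : RowIdx r s m → V n) :
    ∃ (c : ℂ) (e : Fin (r + m) → V n),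
      secantVector lam G = c • exteriorPower.ιMulti ℂ (r + m) e := by
  rcases h with rfl | h
  · exact ⟨_, _, Fin.sum_univ_one _⟩
  let i₀ : Fin s := ⟨0, hs⟩
  obtain rfl | rfl : m = 0 ∨ m = 1 := by omega
  · refine ⟨∑ i, lam i, G ∘ rowSel i₀, ?_⟩
    rw [Finset.sum_smul]
    refine Finset.sum_congr rfl fun i _ => ?_
    congr 2
    ext q : 1
    induction q using Fin.addCases with
    | left a => simp only [Function.comp_apply, rowSel_castAdd]
    | right c => exact c.elim0
  · -- The secant vector is `v_1 ∧ ⋯ ∧ v_r ∧ ∑ i, λ_i w_i`.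
    refine ⟨1, Function.update (G ∘ rowSel i₀) (Fin.natAdd r 0)
      (∑ i, lam i • G (Sum.inr (i, 0))), ?_⟩
    rw [one_smul, AlternatingMap.map_update_sum]
    refine Finset.sum_congr rfl fun i _ => ?_
    rw [AlternatingMap.map_update_smul]
    congr 2
    ext q : 1
    induction q using Fin.addCases with
    | left a =>
      have ha : Fin.castAdd 1 a ≠ Fin.natAdd r 0 := Fin.ne_of_lt a.2
      rw [Function.update_of_ne ha]
      simp only [Function.comp_apply, rowSel_castAdd]
    | right c =>
      obtain rfl := Subsingleton.elim c 0
      rw [Function.update_self, Function.comp_apply, rowSel_natAdd]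

theorem restrictedSecantPoints_eq_grassmannian (hs : 1 ≤ s) (h : s = 1 ∨ m ≤ 1) :
    restrictedSecantPoints (r + m) r s n = grassmannian (r + m) n := by
  refine subset_antisymm (fun x hx => ?_)
    (grassmannian_subset_restrictedSecantPoints (Nat.le_add_right r m) hs)
  induction x with | h w hw =>
  obtain ⟨lam, G, rfl⟩ := exists_secantVector_of_mem hx
  obtain ⟨c, e, he⟩ := exists_secantVector_eq_smul_ιMulti hs h lam G
  have := mk_smul_ιMulti_mem_grassmannian c e (he ▸ hw)
  simpa only [he] using this

theorem restrictedSecant_eq_zariskiClosure_grassmannian (hs : 1 ≤ s) (h : s = 1 ∨ m ≤ 1) :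
    restrictedSecant (r + m) r s n =
      zariskiClosure (pluckerBasis (r + m) n) (grassmannian (r + m) n) := by
  rw [restrictedSecant, restrictedSecantPoints_eq_grassmannian hs h]

theorem projDim_restrictedSecant_eq_projDim_grassmannian (hs : 1 ≤ s) (h : s = 1 ∨ m ≤ 1) :
    projDim (pluckerBasis (r + m) n) (restrictedSecant (r + m) r s n) =
      projDim (pluckerBasis (r + m) n) (grassmannian (r + m) n) := by
  rw [restrictedSecant_eq_zariskiClosure_grassmannian hs h, projDim_zariskiClosure]

end Degenerate

theorem isLeast_orbitStableAt (hs : 1 ≤ s) (hgen : s = 1 ∨ 2 ≤ m) :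
    IsLeast {q | OrbitStableAt (r + m) r s q} (r + s * m) :=
  ⟨orbitStableAt r s m, fun _ hq => not_lt.1 fun hlt => not_orbitStableAt hs hgen hlt hq⟩

theorem isLeast_orbitStableAt_of_degenerate (hs : 1 ≤ s) (h : s = 1 ∨ m ≤ 1) :
    IsLeast {q | OrbitStableAt (r + m) r s q} (r + m) := by
  have heq : restrictedSecant (r + m) r s = restrictedSecant (r + m) (r + m) 1 := by
    ext1 n
    rw [restrictedSecant_eq_zariskiClosure_grassmannian hs h]
    exact (restrictedSecant_eq_zariskiClosure_grassmannian (m := 0) le_rfl (.inl rfl)).symm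
  simp only [OrbitStableAt, heq]
  exact isLeast_orbitStableAt (r := r + m) (m := 0) le_rfl (.inl rfl)

theorem projDim_restrictedSecant {n : ℕ} (hs : 1 ≤ s) (hgen : s = 1 ∨ 2 ≤ m)
    (hn : r + s * m ≤ n) :
    projDim (pluckerBasis (r + m) n) (restrictedSecant (r + m) r s n) =
      ((Algebra.trdeg ℂ (genericPluckerAlgebra r s m ℂ (RowIdx r s m))).toNat - 1 +
        (r + s * m) * (n - (r + s * m)) : ℕ) := by
  have hpos : 1 ≤ (Algebra.trdeg ℂ (genericPluckerAlgebra r s m ℂ (RowIdx r s m))).toNat :=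
    Nat.one_le_iff_ne_zero.2 <| Cardinal.toNat_ne_zero.2
      ⟨trdeg_genericPluckerAlgebra_ne_zero hs (rowSel_injective ⟨0, hs⟩),
        trdeg_pluckerAlgebra_lt_aleph0 _ _⟩
  obtain ⟨e, rfl⟩ := Nat.exists_eq_add_of_le hn
  rw [restrictedSecant, projDim_zariskiClosure, projDim,
    ringKrullDim_restrictedSecantPoints_add hs hgen, Nat.add_sub_cancel_left,
    ← Nat.sub_add_comm hpos]
  rfl

theorem projDim_restrictedSecant_eq {n : ℕ} (h : 2 ≤ s ∧ 3 ≤ m ∨ s = 1 ∧ m = 0)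
    (hn : r + s * m ≤ n) :
    projDim (pluckerBasis (r + m) n) (restrictedSecant (r + m) r s n) =
      (r * (s * m) + s * (m * ((s - 1) * m)) + (s - 1) +
        (r + s * m) * (n - (r + s * m)) : ℕ) := by
  have hs : 1 ≤ s := by omega
  rw [projDim_restrictedSecant hs (by omega) hn, toNat_trdeg_genericPluckerAlgebra h,
    Nat.add_sub_assoc hs]

theorem projDim_grassmannian {p n : ℕ} (hn : p ≤ n) :
    projDim (pluckerBasis p n) (grassmannian p n) = (p * (n - p) : ℕ) := by
  refine (projDim_restrictedSecant_eq_projDim_grassmannian (r := p) (m := 0) le_rfl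
    (.inl rfl)).symm.trans ?_
  simpa using projDim_restrictedSecant_eq (r := p) (.inr ⟨rfl, rfl⟩) hn

end RestrictedSecant

end

open RestrictedSecant

theorem mainTheorem4 (k r s : ℕ) (hr : r ≤ k) (hs : 1 ≤ s) :
    RestrictedSecant.OrbitStableAt k r s (r + s * (k - r)) ∧
    ∀ p : ℕ, IsLeast {q : ℕ | RestrictedSecant.OrbitStableAt k r s q} p →
      ((s = 1 ∨ k ≠ r + 1) → p = r + s * (k - r)) ∧
      ∀ n : ℕ, p ≤ n →
        RestrictedSecant.projDim (RestrictedSecant.pluckerBasis k n)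
            (RestrictedSecant.restrictedSecant k r s n) =
          RestrictedSecant.projDim (RestrictedSecant.pluckerBasis k p)
              (RestrictedSecant.restrictedSecant k r s p) +
            RestrictedSecant.projDim (RestrictedSecant.pluckerBasis p n)
              (RestrictedSecant.grassmannian p n) ∧
        ((2 ≤ s ∧ r + 3 ≤ k) ∨ (s = 1 ∧ (r = 0 ∨ r = k)) →
          RestrictedSecant.projDim (RestrictedSecant.pluckerBasis k n)
              (RestrictedSecant.restrictedSecant k r s n) =
            ((r * (p - r) + s * ((k - r) * (p - k)) + (s - 1) + p * (n - p) : ℕ) :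
              WithBot ℕ∞)) := by
  obtain ⟨m, rfl⟩ := Nat.exists_eq_add_of_le hr
  rw [Nat.add_sub_cancel_left]
  refine ⟨orbitStableAt r s m, fun p hp => ?_⟩
  by_cases hdeg : s = 1 ∨ m ≤ 1
  · obtain rfl := hp.unique (isLeast_orbitStableAt_of_degenerate hs hdeg)
    simp only [projDim_restrictedSecant_eq_projDim_grassmannian hs hdeg]
    refine ⟨fun h => ?_, fun n hn => ⟨?_, fun h => ?_⟩⟩
    · obtain rfl | rfl : s = 1 ∨ m = 0 := by omega
      all_goals simp
    · rw [projDim_grassmannian hn, projDim_grassmannian le_rfl]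
      simp
    · rw [projDim_grassmannian hn]
      obtain ⟨rfl, rfl | rfl⟩ : s = 1 ∧ (r = 0 ∨ m = 0) := by omega
      all_goals simp
  · have hgen : s = 1 ∨ 2 ≤ m := by omega
    obtain rfl := hp.unique (isLeast_orbitStableAt hs hgen)
    refine ⟨fun _ => rfl, fun n hn => ⟨?_, fun h => ?_⟩⟩
    · rw [projDim_restrictedSecant hs hgen hn, projDim_restrictedSecant hs hgen le_rfl,
        projDim_grassmannian hn, Nat.sub_self, mul_zero, add_zero, Nat.cast_add]
    · rw [projDim_restrictedSecant_eq (by omega) hn, Nat.add_sub_cancel_left,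
        Nat.add_sub_add_left, ← Nat.sub_one_mul]
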